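/- Let $d\ge 2$, $\beta_1,\beta_2\in[0,\infty)$ and $K>0$. There is a constant $C>0$, depending only on $d,\beta_1,\beta_2,K$, with the following property. Notation. Cubes have sides parallel to the axes; $3Q$ is the cube concentric with $Q$ and three times its side length. For a cube $Q$, $\|f\|_{L(\log L)^{\beta},Q}=\inf\{\lambda>0:\frac1{|Q|}\int_Q\frac{|f|}{\lambda}\log^{\beta}(e+\frac{|f|}{\lambda})\,dx\le1\}$ and $\langle|g|\rangle_{Q,r}=(\frac1{|Q|}\int_Q|g|^r\,dx)^{1/r}$. A family $\mathcal S$ of cubes is $\eta$-sparse if there are pairwise disjoint measurable sets $E_Q\subset Q$ $(Q\in\mathcal S)$ with $|E_Q|\ge\eta|Q|$, and $\mathcal A_{\mathcal S;L(\log L)^{\beta},L^r}(f,g)=\sum_{Q\in\mathcal S}|Q|\,\|f\|_{L(\log L)^{\beta},Q}\,\langle|g|\rangle_{Q,r}\in[0,\infty]$. For a linear operator $T$ and $1\le q<\infty$, $$\mathscr M_{T,q}f(x)=\sup_{Q\ni x}|Q|^{-1/q}\big\|T(f\chi_{\mathbb R^d\setminus 3Q})\chi_Q\big\|_{L^q(\mathbb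 R^d)},$$ the supremum being over all cubes $Q$ containing $x$. Let $r\in(1,3/2]$, $r'=r/(r-1)$, $A,A_0,A_1,A_2\ge0$, and let $T_1,T_2$ be linear operators, each defined on a linear space of (classes modulo a.e. equality of) measurable functions on $\mathbb R^d$ and with values in such functions, such that $T_2f$, $T_1T_2f$ and $T_1(\chi_{\mathbb R^d\setminus 3Q}T_2f)$ are defined for all bounded functions $f$ with compact support and all cubes $Q$. Suppose that (i) $T_1$ is defined and bounded on $L^{r'}(\mathbb R^d)$ with bound $A$, i.e. $\|T_1h\|_{L^{r'}}\le A\|h\|_{L^{r'}}$; and that, for every bounded function $f$ with compact support and every $\lambda>0$, (ii) $\displaystyle|\{x:|T_1T_2f(x)|>\lambda\}|\le K\int_{\mathbb R^d}\frac{A_0|f|}{\lambda}\log^{\beta_1}\Big(e+\frac{A_0|f|}{\lambda}\Big)dx$; (iii) $\displaystyle|\{x:\mathscr M_{T_1,r'}(T_2f)(x)>\lambda\}|\le K\int_{\mathbb R^d}\frac{A_1|f|}{\lambda}\log^{\beta_1}\Big(e+\frac{A_1|f|}{\lambda}\Big)dx$ and $\displaystyle|\{x:\mathscr M_{T_2,r'}f(x)>\lambda\}|\le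 K\int_{\mathbb R^d}\frac{A_2|f|}{\lambda}\log^{\beta_2}\Big(e+\frac{A_2|f|}{\lambda}\Big)dx$. Then for every bounded function $f$ with compact support there exist a $\frac12\frac1{9^d}$-sparse family $\mathcal S$ of cubes and measurable functions $H_1,H_2$ such that, for every measurable function $g$, $$\Big|\int_{\mathbb R^d}H_1g\,dx\Big|\le C(A_0+A_1)\,\mathcal A_{\mathcal S;L(\log L)^{\beta_1},L^r}(f,g),\qquad \Big|\int_{\mathbb R^d}H_2g\,dx\Big|\le C\,A\,A_2\,\mathcal A_{\mathcal S;L(\log L)^{\beta_2},L^r}(f,g),$$ and $T_1T_2f(x)=H_1(x)+H_2(x)$ for a.e. $x\in\mathbb R^d$. Here $H_ig$ is integrable whenever the sparse form in the corresponding estimate is finite; if that form is infinite, the estimate is understood with values in $[0,\infty]$. -/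

import Mathlib

open MeasureTheory
open scoped ENNReal

/-- Classes, modulo almost everywhere equality, of (strongly) measurable functions `ℝ^d → 𝕜`,
with respect to Lebesgue measure. -/
abbrev MeasFun (d : ℕ) (𝕜 : Type*) [RCLike 𝕜] : Type _ :=
  (Fin d → ℝ) →ₘ[(volume : Measure (Fin d → ℝ))] 𝕜

/-- A linear operator between measurable functions on `ℝ^d`, defined on a linear subspace
`T.domain` of `MeasFun d 𝕜`. -/
abbrev LinOp (d : ℕ) (𝕜 : Type*) [RCLike 𝕜] : Type _ :=
  MeasFun d 𝕜 →ₗ.[𝕜] MeasFun d 𝕜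

/-- A cube in `ℝ^d` with sides parallel to the axes, given by its center and side length. -/
@[ext]
structure Cube (d : ℕ) where
  center : Fin d → ℝ
  side : ℝ
  side_pos : 0 < side

namespace Cube

variable {d : ℕ}

/-- The (closed) cube as a set. -/
def toSet (Q : Cube d) : Set (Fin d → ℝ) :=
  {x | ∀ i, |x i - Q.center i| ≤ Q.side / 2}

/-- The concentric cube `3Q`. -/
def triple (Q : Cube d) : Cube d where
  center := Q.center
  side := 3 * Q.side
  side_pos := mul_pos (by norm_num) Q.side_pos

theorem measurableSet_toSet (Q : Cube d) : MeasurableSet Q.toSet := by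
  have h : Q.toSet = ⋂ i, {x : Fin d → ℝ | |x i - Q.center i| ≤ Q.side / 2} := by
    ext x
    simp [toSet]
  rw [h]
  exact MeasurableSet.iInter fun i =>
    measurableSet_le ((measurable_pi_apply i).sub_const _).abs measurable_const

end Cube

noncomputable section

/-- The function `f χ_{ℝ^d \ 3Q}`. -/
def cutOff {d : ℕ} {𝕜 : Type*} [RCLike 𝕜] (Q : Cube d) (f : MeasFun d 𝕜) : MeasFun d 𝕜 :=
  AEEqFun.mk ((Q.triple.toSet)ᶜ.indicator (f : (Fin d → ℝ) → 𝕜))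
    (f.aestronglyMeasurable.indicator Q.triple.measurableSet_toSet.compl)

open Classical in
/-- The function `T f`, for `f` in the domain of `T` (and, by convention, `0` otherwise). -/
def opApply {d : ℕ} {𝕜 : Type*} [RCLike 𝕜] (T : LinOp d 𝕜) (f : MeasFun d 𝕜) : MeasFun d 𝕜 :=
  if h : f ∈ T.domain then T ⟨f, h⟩ else 0

/-- `f` is bounded with compact support (as a class modulo a.e. equality). -/
def IsBddCompactSupp {d : ℕ} {𝕜 : Type*} [RCLike 𝕜] (f : MeasFun d 𝕜) : Prop :=
  (∃ M : ℝ, ∀ᵐ x, ‖f x‖ ≤ M) ∧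
    ∃ B : Set (Fin d → ℝ), IsCompact B ∧ ∀ᵐ x, x ∉ B → f x = 0

/-- `T` is defined on `L^q(ℝ^d)` and bounded there with bound `A`. -/
def BoundedOnLp {d : ℕ} {𝕜 : Type*} [RCLike 𝕜] (T : LinOp d 𝕜) (q A : ℝ) : Prop :=
  ∀ f : MeasFun d 𝕜, MemLp f (ENNReal.ofReal q) volume →
    f ∈ T.domain ∧
      eLpNorm (opApply T f) (ENNReal.ofReal q) volume ≤
        ENNReal.ofReal A * eLpNorm f (ENNReal.ofReal q) volume

/-- The grand maximal operator
`𝓜_{T,q} f(x) = sup_{Q ∋ x} |Q|^{-1/q} ‖T(f χ_{ℝ^d \ 3Q}) χ_Q‖_{L^q}`. -/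
def grandMaximal {d : ℕ} {𝕜 : Type*} [RCLike 𝕜] (T : LinOp d 𝕜) (q : ℝ) (f : MeasFun d 𝕜)
    (x : Fin d → ℝ) : ℝ≥0∞ :=
  ⨆ (Q : Cube d) (_ : x ∈ Q.toSet),
    volume Q.toSet ^ (-(1 / q)) *
      eLpNorm (Q.toSet.indicator (opApply T (cutOff Q f) : (Fin d → ℝ) → 𝕜))
        (ENNReal.ofReal q) volume

/-- The Young function `u ↦ u log^β (e + u)`. -/
def youngLog (β u : ℝ) : ℝ := u * Real.log (Real.exp 1 + u) ^ β

/-- The `L (log L)^β` weak type bound with constant `A` and implied constant `K`,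
`|{x : Uf(x) > t}| ≤ K ∫ (A|f|/t) log^β (e + A|f|/t)` for all `t > 0`,
for an operator `U` acting on bounded functions `f` with compact support. -/
def WeakLLogL {d : ℕ} {𝕜 : Type*} [RCLike 𝕜] (U : MeasFun d 𝕜 → (Fin d → ℝ) → ℝ≥0∞)
    (β A K : ℝ) : Prop :=
  ∀ f : MeasFun d 𝕜, IsBddCompactSupp f → ∀ t : ℝ, 0 < t →
    volume {x | ENNReal.ofReal t < U f x} ≤
      ENNReal.ofReal K * ∫⁻ x, ENNReal.ofReal (youngLog β (A * ‖f x‖ / t))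

/-- The Luxemburg norm `‖f‖_{L(log L)^β, Q}`. -/
def normLLogL {d : ℕ} {𝕜 : Type*} [RCLike 𝕜] (β : ℝ) (Q : Cube d) (f : (Fin d → ℝ) → 𝕜) :
    ℝ≥0∞ :=
  ⨅ (t : ℝ) (_ : 0 < t)
    (_ : (volume Q.toSet)⁻¹ * ∫⁻ x in Q.toSet, ENNReal.ofReal (youngLog β (‖f x‖ / t)) ≤ 1),
    ENNReal.ofReal t

/-- `⟨|g|⟩_{Q,r} = (|Q|⁻¹ ∫_Q |g|^r)^{1/r}`. -/
def avgLp {d : ℕ} {𝕜 : Type*} [RCLike 𝕜] (r : ℝ) (Q : Cube d) (g : (Fin d → ℝ) → 𝕜) : ℝ≥0∞ :=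
  ((volume Q.toSet)⁻¹ * ∫⁻ x in Q.toSet, ‖g x‖ₑ ^ r) ^ (1 / r)

/-- `S` is an `η`-sparse family of cubes. -/
def IsSparse {d : ℕ} (η : ℝ) (S : Set (Cube d)) : Prop :=
  ∃ E : Cube d → Set (Fin d → ℝ),
    (∀ Q ∈ S, MeasurableSet (E Q) ∧ E Q ⊆ Q.toSet ∧
      ENNReal.ofReal η * volume Q.toSet ≤ volume (E Q)) ∧
    S.PairwiseDisjoint E

/-- The bilinear sparse form
`𝓐_{S; L(log L)^β, L^r}(f,g) = ∑_{Q ∈ S} |Q| ‖f‖_{L(log L)^β,Q} ⟨|g|⟩_{Q,r}`, in `[0,∞]`. -/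
def sparseForm {d : ℕ} {𝕜 : Type*} [RCLike 𝕜] (S : Set (Cube d)) (β r : ℝ)
    (f g : (Fin d → ℝ) → 𝕜) : ℝ≥0∞ :=
  ∑' Q : S, volume (Q : Cube d).toSet * normLLogL β (Q : Cube d) f * avgLp r (Q : Cube d) g

/-- `|∫ H g| ≤ A 𝓐_{S; L(log L)^β, L^r}(f,g)` for every measurable `g`, where the integral
converges absolutely as soon as the sparse form is finite. -/
def SparseControlled {d : ℕ} {𝕜 : Type*} [RCLike 𝕜] (H : MeasFun d 𝕜) (A : ℝ)
    (S : Set (Cube d)) (β r : ℝ) (f : MeasFun d 𝕜) : Prop :=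
  ∀ g : (Fin d → ℝ) → 𝕜, AEStronglyMeasurable g volume →
    (sparseForm S β r f g ≠ ∞ → Integrable (fun x => H x * g x) volume) ∧
      ‖∫ x, H x * g x‖ₑ ≤ ENNReal.ofReal A * sparseForm S β r f g

end

/-! ### Dyadic cubes -/

/-! Fix `f` and write f_Q = f χ_{9Q} for a dyadic cube Q. For a dyadic P inside Q, cutting at 3P
gives T₁T₂f_Q = T₁(χ_{(3P)ᶜ} T₂f_Q) − T₁(χ_{(3P)ᶜ} T₂f_P) + T₁(χ_{3P} T₂(f_Q − f_P)) + T₁T₂f_P.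
Descending from Q to P thus costs three errors. The first has a controlled L^{r'} average over P
once P contains a point where the grand maximal function of T₁ at T₂f_Q is not large; the second is
of the same kind with P in the role of Q. For the third, f_Q − f_P = f_Q χ_{(9P)ᶜ}, so the grand
maximal function of T₂, tested on the cube 3P, controls T₂(f_Q − f_P) in L^{r'}(3P), and T₁ is
bounded on L^{r'}. The first two errors feed H₁, the third feeds H₂.

Let E(Q) be the set where T₁T₂f_Q or one of the two maximal functions exceeds a large multiple of
the Luxemburg norm of `f` on 9Q. The weak type bounds give |E(Q)| ≤ 2^(-d-2)|Q|
(`WeakLLogL.volume_lt_le`). The children of Q are the maximal dyadic subcubes in which E(Q) has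
density above 2^(-d-1): they cover almost all of E(Q) ∩ Q, fill at most half of Q, and each contains
a point outside E(Q). Off the children T₁T₂f_Q itself is bounded, and goes into H₁.

The iteration starts from a partition of the space into cubes whose ninefold dilates contain the
support of `f`, so that there T₁T₂f_Q = T₁T₂f. Almost every point lies in finitely many stopping
cubes, hence the telescoping sum is finite (`exists_decomposition_of_stoppingCube`). Hölder turns
each average into a term of the sparse form (`lintegral_stoppingCube_le_sparseForm`), and the part
of Q outside its children witnesses sparseness of the dilated cubes (`stoppingFamily_isSparse`). -/

/-- The index of the dyadic cube of side `2 ^ (-n)` containing `x`. -/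
noncomputable def dyadicIndex {d : ℕ} (n : ℤ) (x : Fin d → ℝ) : Fin d → ℤ :=
  fun i => ⌊(2 : ℝ) ^ n * x i⌋

/-- Labels of dyadic cubes: the level `n` (the side being `2 ^ (-n)`) and the index. -/
abbrev DyadicLabel (d : ℕ) : Type := ℤ × (Fin d → ℤ)

/-- The label of the dyadic cube of level `n` containing `x`. -/
noncomputable def dyadicAt {d : ℕ} (n : ℤ) (x : Fin d → ℝ) : DyadicLabel d := (n, dyadicIndex n x)

/-- The half-open dyadic cube with a given label. -/
def dyadicSet {d : ℕ} (Q : DyadicLabel d) : Set (Fin d → ℝ) := {x | dyadicIndex Q.1 x = Q.2}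

/-- The closed dyadic cube with a given label. -/
noncomputable def dyadicCube {d : ℕ} (Q : DyadicLabel d) : Cube d where
  center := fun i => ((Q.2 i : ℝ) + 1 / 2) * (2 : ℝ) ^ (-Q.1)
  side := (2 : ℝ) ^ (-Q.1)
  side_pos := by positivity

/-- The closed dyadic cube with a given label, dilated nine times. -/
noncomputable def dyadicNine {d : ℕ} (Q : DyadicLabel d) : Cube d := (dyadicCube Q).triple.triple

section Dyadic

variable {d : ℕ}

theorem dyadicIndex_sub_nat (n : ℤ) (j : ℕ) (x : Fin d → ℝ) (i : Fin d) :
    dyadicIndex (n - j) x i = dyadicIndex n x i / (2 ^ j : ℕ) := by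
  unfold dyadicIndex
  rw [← Int.floor_div_natCast]
  congr 1
  rw [zpow_sub₀ (by norm_num)]
  push_cast
  rw [zpow_natCast]
  ring

/-- Nestedness of the dyadic grid: the coarser index is the integer quotient of the finer one by a
power of two. -/
theorem dyadicIndex_eq_of_le {m n : ℤ} (h : m ≤ n) {x y : Fin d → ℝ}
    (hxy : dyadicIndex n x = dyadicIndex n y) : dyadicIndex m x = dyadicIndex m y := by
  obtain ⟨j, hj⟩ := Int.le.dest h
  obtain rfl : m = n - j := by omega
  ext i
  rw [dyadicIndex_sub_nat, dyadicIndex_sub_nat, hxy]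

theorem mem_dyadicSet {Q : DyadicLabel d} {x : Fin d → ℝ} :
    x ∈ dyadicSet Q ↔ dyadicIndex Q.1 x = Q.2 := Iff.rfl

theorem mem_dyadicSet_dyadicAt {n : ℤ} {x y : Fin d → ℝ} :
    y ∈ dyadicSet (dyadicAt n x) ↔ dyadicIndex n y = dyadicIndex n x := Iff.rfl

theorem self_mem_dyadicSet (n : ℤ) (x : Fin d → ℝ) : x ∈ dyadicSet (dyadicAt n x) := rfl

theorem dyadicSet_subset {P Q : DyadicLabel d} (h : Q.1 ≤ P.1) {x : Fin d → ℝ}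
    (hP : x ∈ dyadicSet P) (hQ : x ∈ dyadicSet Q) : dyadicSet P ⊆ dyadicSet Q := by
  intro y hy
  rw [mem_dyadicSet] at *
  rw [← hQ]
  exact dyadicIndex_eq_of_le h (hy.trans hP.symm)

theorem dyadicSet_eq_pi (Q : DyadicLabel d) :
    dyadicSet Q = Set.univ.pi fun i =>
      Set.Ico ((Q.2 i : ℝ) * (2 : ℝ) ^ (-Q.1)) (((Q.2 i : ℝ) + 1) * (2 : ℝ) ^ (-Q.1)) := by
  have h2 : (0 : ℝ) < 2 ^ Q.1 := by positivity
  ext x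
  simp only [mem_dyadicSet, funext_iff, dyadicIndex, Int.floor_eq_iff, Set.mem_univ_pi, Set.mem_Ico,
    zpow_neg, ← div_eq_mul_inv, div_le_iff₀ h2, lt_div_iff₀ h2, mul_comm ((2 : ℝ) ^ Q.1)]

theorem measurableSet_dyadicSet (Q : DyadicLabel d) : MeasurableSet (dyadicSet Q) := by
  rw [dyadicSet_eq_pi]
  exact MeasurableSet.univ_pi fun i => measurableSet_Ico

theorem volume_dyadicSet (Q : DyadicLabel d) :
    volume (dyadicSet Q) = ENNReal.ofReal ((2 : ℝ) ^ (-Q.1)) ^ d := by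
  rw [dyadicSet_eq_pi, Real.volume_pi_Ico]
  simp [add_mul]

theorem Cube.toSet_eq_closedBall (Q : Cube d) :
    Q.toSet = Metric.closedBall Q.center (Q.side / 2) := by
  ext x
  rw [Metric.mem_closedBall, dist_pi_le_iff (by have := Q.side_pos; positivity)]
  rfl

theorem Cube.volume_toSet (Q : Cube d) : volume Q.toSet = ENNReal.ofReal Q.side ^ d := by
  rw [Q.toSet_eq_closedBall, Real.volume_pi_closedBall _ (by have := Q.side_pos; positivity),
    ENNReal.ofReal_pow (by have := Q.side_pos; positivity)]
  simp [mul_div_cancel₀]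

theorem Cube.volume_toSet_ne_top (Q : Cube d) : volume Q.toSet ≠ ∞ := by
  rw [Q.volume_toSet]; exact ENNReal.pow_ne_top ENNReal.ofReal_ne_top

theorem Cube.volume_toSet_ne_zero (Q : Cube d) : volume Q.toSet ≠ 0 := by
  rw [Q.volume_toSet]; exact pow_ne_zero _ (by simpa using Q.side_pos)

theorem Cube.volume_triple (Q : Cube d) : volume Q.triple.toSet = 3 ^ d * volume Q.toSet := by
  rw [Cube.volume_toSet, Cube.volume_toSet, ← mul_pow]
  congr 1
  simp only [Cube.triple]
  rw [ENNReal.ofReal_mul (by norm_num)]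
  simp

theorem Cube.toSet_subset_triple (Q : Cube d) : Q.toSet ⊆ Q.triple.toSet := by
  intro x hx i
  have := Q.side_pos
  exact (hx i).trans (by simp only [Cube.triple]; linarith)

theorem volume_dyadicCube (Q : DyadicLabel d) :
    volume (dyadicCube Q).toSet = volume (dyadicSet Q) := by
  rw [Cube.volume_toSet, volume_dyadicSet]; rfl

theorem volume_dyadicSet_ne_top (Q : DyadicLabel d) : volume (dyadicSet Q) ≠ ∞ :=
  volume_dyadicCube Q ▸ (dyadicCube Q).volume_toSet_ne_top

theorem volume_dyadicSet_ne_zero (Q : DyadicLabel d) : volume (dyadicSet Q) ≠ 0 :=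
  volume_dyadicCube Q ▸ (dyadicCube Q).volume_toSet_ne_zero

theorem volume_dyadicNine (Q : DyadicLabel d) :
    volume (dyadicNine Q).toSet = 9 ^ d * volume (dyadicSet Q) := by
  rw [dyadicNine, Cube.volume_triple, Cube.volume_triple, volume_dyadicCube, ← mul_assoc, ← mul_pow]
  norm_num

theorem dyadicSet_subset_dyadicCube (Q : DyadicLabel d) : dyadicSet Q ⊆ (dyadicCube Q).toSet := by
  intro x hx i
  rw [dyadicSet_eq_pi] at hx
  have := hx i (Set.mem_univ i)
  rw [Set.mem_Ico] at this
  simp only [dyadicCube]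
  rw [abs_le]
  constructor <;> linarith

theorem dyadicSet_subset_dyadicNine (Q : DyadicLabel d) : dyadicSet Q ⊆ (dyadicNine Q).toSet :=
  (dyadicSet_subset_dyadicCube Q).trans
    ((Cube.toSet_subset_triple _).trans (Cube.toSet_subset_triple _))

theorem dyadicSet_ae_eq_dyadicCube (Q : DyadicLabel d) :
    dyadicSet Q =ᵐ[volume] (dyadicCube Q).toSet :=
  ae_eq_of_subset_of_measure_ge (dyadicSet_subset_dyadicCube Q) (volume_dyadicCube Q).le
    (measurableSet_dyadicSet Q).nullMeasurableSet (Cube.volume_toSet_ne_top _)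

theorem dyadicNine_injective : Function.Injective (dyadicNine (d := d)) := by
  rintro ⟨n, k⟩ ⟨n', k'⟩ h
  have hs := congrArg Cube.side h
  have hc := congrArg Cube.center h
  simp only [dyadicNine, Cube.triple, dyadicCube] at hs hc
  have hn : (2 : ℝ) ^ (-n) = 2 ^ (-n') := by linarith
  have hn' : n = n' := by
    have := zpow_right_injective₀ (a := (2 : ℝ)) (by norm_num) (by norm_num) hn
    omega
  subst hn'
  congr 1
  ext i
  have := congrFun hc i
  have h2 : (2 : ℝ) ^ (-n) ≠ 0 := by positivity
  have := mul_right_cancel₀ h2 this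
  exact_mod_cast add_right_cancel this

theorem volume_dyadicSet_parent (n : ℤ) (x : Fin d → ℝ) :
    volume (dyadicSet (dyadicAt n x)) = 2 ^ d * volume (dyadicSet (dyadicAt (n + 1) x)) := by
  rw [volume_dyadicSet, volume_dyadicSet, ← mul_pow]
  congr 1
  simp only [dyadicAt]
  rw [neg_add, zpow_add₀ (by norm_num), ENNReal.ofReal_mul (by positivity)]
  rw [mul_comm (ENNReal.ofReal _), ← mul_assoc]
  simp
  rw [ENNReal.mul_inv_cancel (by norm_num) (by norm_num), one_mul]

theorem Cube.triple_toSet_mono {P Q : Cube d} (h : P.toSet ⊆ Q.toSet) :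
    P.triple.toSet ⊆ Q.triple.toSet := by
  -- Testing the inclusion on the two extreme corners of `P` gives this inequality; it survives
  -- tripling because the distance of the centers is not multiplied.
  have key : ∀ i, |P.center i - Q.center i| + P.side / 2 ≤ Q.side / 2 := by
    intro i
    have hp := P.side_pos
    have h1 : (fun j => P.center j + P.side / 2) ∈ P.toSet := by
      intro j; rw [add_sub_cancel_left, abs_of_pos (by positivity)]
    have h2 : (fun j => P.center j - P.side / 2) ∈ P.toSet := by
      intro j; rw [sub_sub_cancel_left, abs_neg, abs_of_pos (by positivity)]
    have h1 := abs_le.1 (h h1 i)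
    have h2 := abs_le.1 (h h2 i)
    rcases abs_cases (P.center i - Q.center i) with h | h <;> linarith
  intro x hx i
  have h1 := hx i
  have h2 := key i
  have := abs_nonneg (P.center i - Q.center i)
  have h3 := abs_sub_le (x i) (P.center i) (Q.center i)
  simp only [Cube.triple] at *
  linarith

theorem dyadicNine_mono {P Q : DyadicLabel d} (h : Q.1 ≤ P.1) {x : Fin d → ℝ}
    (hP : x ∈ dyadicSet P) (hQ : x ∈ dyadicSet Q) :
    (dyadicNine P).toSet ⊆ (dyadicNine Q).toSet := by
  refine Cube.triple_toSet_mono (Cube.triple_toSet_mono ?_)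
  have hsub := dyadicSet_subset h hP hQ
  have hcl : ∀ R : DyadicLabel d, closure (dyadicSet R) = (dyadicCube R).toSet := by
    intro R
    have : (2 : ℝ) ^ (-R.1) > 0 := by positivity
    rw [dyadicSet_eq_pi, closure_pi_set]
    ext x
    simp only [Set.mem_univ_pi, Cube.toSet, dyadicCube, Set.mem_ofPred_eq]
    refine forall_congr' fun i => ?_
    rw [closure_Ico (by intro h; linarith), Set.mem_Icc, abs_le]
    constructor <;> rintro ⟨h1, h2⟩ <;> constructor <;> linarith
  rw [← hcl, ← hcl]
  exact closure_mono hsub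

/-- Almost every point of a set is a density point with respect to dyadic cubes. -/
theorem ae_exists_dyadic_density (E : Set (Fin d → ℝ)) {c : ℝ≥0∞} (hc : c < 1) (n : ℤ) :
    ∀ᵐ x ∂(volume.restrict E), ∃ j : ℕ,
      c * volume (dyadicSet (dyadicAt (n + j) x)) < volume (dyadicSet (dyadicAt (n + j) x) ∩ E) := by
  filter_upwards [IsUnifLocDoublingMeasure.ae_tendsto_measure_inter_div volume E 1] with x hx
  have h0 : Filter.Tendsto (fun j : ℕ => (dyadicCube (dyadicAt (n + j) x)).side / 2) Filter.atTop
      (nhdsWithin 0 (Set.Ioi 0)) := by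
    refine tendsto_nhdsWithin_iff.2 ⟨?_, Filter.Eventually.of_forall fun j => ?_⟩
    · have : (fun j : ℕ => (dyadicCube (dyadicAt (n + j) x)).side / 2) =
          fun j : ℕ => (2 : ℝ) ^ (-n) / 2 * (1 / 2) ^ j := by
        ext j
        simp only [dyadicCube, dyadicAt]
        rw [neg_add, zpow_add₀ (by norm_num), zpow_neg _ (j : ℤ), zpow_natCast]
        rw [one_div, inv_pow]
        ring
      rw [this]
      simpa using (tendsto_pow_atTop_nhds_zero_of_lt_one (r := (1 / 2 : ℝ)) (by norm_num)
        (by norm_num)).const_mul ((2 : ℝ) ^ (-n) / 2)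
    · have := (dyadicCube (dyadicAt (n + j) x)).side_pos
      exact Set.mem_Ioi.2 (by positivity)
  have h1 := hx (fun j : ℕ => (dyadicCube (dyadicAt (n + j) x)).center) _ h0
    (Filter.Eventually.of_forall fun j => by
      -- Closed dyadic cubes are sup-norm balls containing `x` but not centered at it, which the
      -- density theorem for doubling measures allows. It needs no measurability of `E`.
      rw [one_mul, ← Cube.toSet_eq_closedBall]
      exact dyadicSet_subset_dyadicCube _ (self_mem_dyadicSet _ x))
  obtain ⟨j, hj⟩ := (h1.eventually_const_lt hc).exists
  refine ⟨j, ?_⟩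
  rw [← Cube.toSet_eq_closedBall] at hj
  have hae := dyadicSet_ae_eq_dyadicCube (dyadicAt (n + j) x)
  rw [← volume_dyadicCube, measure_congr (hae.inter (ae_eq_refl E)), Set.inter_comm]
  rwa [ENNReal.lt_div_iff_mul_lt (Or.inl (Cube.volume_toSet_ne_zero _))
    (Or.inl (Cube.volume_toSet_ne_top _))] at hj

end Dyadic

/-! ### Selections of dyadic cubes -/

section Selection

variable {d : ℕ}

/-- `ν` selects at most one dyadic cube around each point, and is constant on selected cubes. -/
structure IsSelection (ν : (Fin d → ℝ) → Option (DyadicLabel d)) : Prop where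
  mem : ∀ {x Q}, ν x = some Q → x ∈ dyadicSet Q
  const : ∀ {x Q y}, ν x = some Q → y ∈ dyadicSet Q → ν y = some Q

namespace IsSelection

variable {ν : (Fin d → ℝ) → Option (DyadicLabel d)}

theorem fiber_eq (hν : IsSelection ν) {x : Fin d → ℝ} {Q : DyadicLabel d} (h : ν x = some Q) :
    {y | ν y = some Q} = dyadicSet Q :=
  Set.Subset.antisymm (fun _ hy => hν.mem hy) fun _ hy => hν.const h hy

theorem measurableSet_fiber (hν : IsSelection ν) (o : Option (DyadicLabel d)) :
    MeasurableSet {x | ν x = o} := by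
  have hsome : ∀ Q, MeasurableSet {x | ν x = some Q} := by
    intro Q
    rcases Set.eq_empty_or_nonempty {x | ν x = some Q} with h | ⟨x, hx⟩
    · rw [h]; exact MeasurableSet.empty
    · rw [hν.fiber_eq hx]; exact measurableSet_dyadicSet Q
  cases o with
  | some Q => exact hsome Q
  | none =>
    have : {x | ν x = none} = (⋃ Q, {x | ν x = some Q})ᶜ := by
      ext x
      simp [Option.eq_none_iff_forall_ne_some]
    rw [this]
    exact (MeasurableSet.iUnion hsome).compl

theorem pairwise_disjoint_fiber (ν : (Fin d → ℝ) → Option (DyadicLabel d)) :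
    Pairwise (Function.onFun Disjoint fun o => {x | ν x = o}) := by
  intro o o' h
  exact Set.disjoint_left.2 fun x hx hx' => h (hx.symm.trans hx')

theorem lintegral_eq_tsum (hν : IsSelection ν) (μ : Measure (Fin d → ℝ)) (F : (Fin d → ℝ) → ℝ≥0∞) :
    ∫⁻ x, F x ∂μ = ∑' o, ∫⁻ x in {x | ν x = o}, F x ∂μ := by
  rw [← lintegral_iUnion hν.measurableSet_fiber (pairwise_disjoint_fiber ν)]
  have : ⋃ o, {x | ν x = o} = Set.univ := by ext x; simp
  rw [this, Measure.restrict_univ]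

theorem measure_eq_tsum (hν : IsSelection ν) (μ : Measure (Fin d → ℝ)) :
    μ Set.univ = ∑' o, μ {x | ν x = o} := by
  simpa using hν.lintegral_eq_tsum μ 1

theorem aemeasurable_comp {β : Type*} [MeasurableSpace β] (hν : IsSelection ν)
    {μ : Measure (Fin d → ℝ)} {V : Option (DyadicLabel d) → (Fin d → ℝ) → β}
    (hV : ∀ o, AEMeasurable (V o) μ) : AEMeasurable (fun x => V (ν x) x) μ := by
  have : ⋃ o, {x | ν x = o} = Set.univ := by ext x; simp
  rw [← Measure.restrict_univ (μ := μ), ← this, aemeasurable_iUnion_iff]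
  intro o
  refine (hV o).restrict.congr ?_
  filter_upwards [ae_restrict_mem (hν.measurableSet_fiber o)] with x hx
  rw [show ν x = o from hx]

/-- A bound on the average over each selected cube, and over the unselected rest, adds up because
the fibers of `ν` form a countable measurable partition. -/
theorem lintegral_comp_le (hν : IsSelection ν) {A : Set (Fin d → ℝ)}
    {V : Option (DyadicLabel d) → (Fin d → ℝ) → ℝ≥0∞} {κ : ℝ≥0∞}
    (hV : ∀ o, ∫⁻ x in {x | ν x = o} ∩ A, V o x ≤ κ * volume ({x | ν x = o} ∩ A)) :
    ∫⁻ x in A, V (ν x) x ≤ κ * volume A := by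
  have hm := hν.measurableSet_fiber
  rw [hν.lintegral_eq_tsum, ← Measure.restrict_apply_univ A, hν.measure_eq_tsum,
    ← ENNReal.tsum_mul_left]
  refine ENNReal.tsum_le_tsum fun o => ?_
  rw [Measure.restrict_apply (hm o), Measure.restrict_restrict (hm o)]
  refine le_trans (le_of_eq ?_) (hV o)
  rw [← Measure.restrict_restrict (hm o)]
  exact setLIntegral_congr_fun (hm o) fun x hx => by simp only [show ν x = o from hx]

end IsSelection

open Classical in
/-- The maximal dyadic subcube of `Q` containing `x` on which `E` has density more than
`2 ^ (-d-1)`, if there is one. -/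
noncomputable def nextCube (E : Set (Fin d → ℝ)) (Q : DyadicLabel d) (x : Fin d → ℝ) :
    Option (DyadicLabel d) :=
  if h : x ∈ dyadicSet Q ∧ ∃ j : ℕ, (2 ^ (d + 1) : ℝ≥0∞)⁻¹ * volume (dyadicSet (dyadicAt (Q.1 + j) x))
      < volume (dyadicSet (dyadicAt (Q.1 + j) x) ∩ E)
  then some (dyadicAt (Q.1 + Nat.find h.2) x) else none

theorem nextCube_eq_some_iff {E : Set (Fin d → ℝ)} {Q P : DyadicLabel d} {x : Fin d → ℝ} :
    nextCube E Q x = some P ↔ x ∈ dyadicSet Q ∧ ∃ j : ℕ, P = dyadicAt (Q.1 + j) x ∧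
      (2 ^ (d + 1) : ℝ≥0∞)⁻¹ * volume (dyadicSet (dyadicAt (Q.1 + j) x))
        < volume (dyadicSet (dyadicAt (Q.1 + j) x) ∩ E) ∧
      ∀ i < j, volume (dyadicSet (dyadicAt (Q.1 + i) x) ∩ E) ≤
        (2 ^ (d + 1) : ℝ≥0∞)⁻¹ * volume (dyadicSet (dyadicAt (Q.1 + i) x)) := by
  classical
  unfold nextCube
  split_ifs with h
  · rw [Option.some_inj]
    constructor
    · rintro rfl
      exact ⟨h.1, _, rfl, Nat.find_spec h.2, fun i hi => not_lt.1 (Nat.find_min h.2 hi)⟩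
    · rintro ⟨-, j, rfl, hj, hi⟩
      congr
      exact (Nat.find_eq_iff h.2).2 ⟨hj, fun i hij => not_lt.2 (hi i hij)⟩
  · simp only [false_iff]
    rintro ⟨hx, j, -, hj, -⟩
    exact h ⟨hx, j, hj⟩

theorem nextCube_isSelection (E : Set (Fin d → ℝ)) (Q : DyadicLabel d) :
    IsSelection (nextCube E Q) where
  mem := by
    intro x P h
    obtain ⟨-, j, rfl, -⟩ := nextCube_eq_some_iff.1 h
    exact self_mem_dyadicSet _ x
  const := by
    intro x P y h hy
    obtain ⟨hx, j, rfl, hj, hi⟩ := nextCube_eq_some_iff.1 h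
    rw [mem_dyadicSet_dyadicAt] at hy
    -- Points of the selected cube share all its dyadic ancestors up to `Q`, so the stopping test
    -- reads the same numbers at `x` and at `y`.
    have key : ∀ i ≤ j, dyadicAt (Q.1 + i) y = dyadicAt (Q.1 + i) x := by
      intro i hij
      unfold dyadicAt
      rw [dyadicIndex_eq_of_le (by omega) hy]
    refine nextCube_eq_some_iff.2 ⟨?_, j, (key j le_rfl).symm, ?_, ?_⟩
    · rw [mem_dyadicSet] at hx ⊢
      rw [← hx]
      exact dyadicIndex_eq_of_le (by omega) hy
    · rwa [key j le_rfl]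
    · intro i hij
      rw [key i hij.le]
      exact hi i hij

theorem mem_of_nextCube_eq_some {E : Set (Fin d → ℝ)} {Q P : DyadicLabel d} {x : Fin d → ℝ}
    (h : nextCube E Q x = some P) : x ∈ dyadicSet Q := (nextCube_eq_some_iff.1 h).1

theorem dyadicAt_fst_of_mem {Q : DyadicLabel d} {x : Fin d → ℝ} (hx : x ∈ dyadicSet Q) :
    dyadicAt Q.1 x = Q := Prod.ext rfl hx

/-! ### Children of a cube when the exceptional set is small -/

section Small

variable {E : Set (Fin d → ℝ)} {Q P : DyadicLabel d} {x : Fin d → ℝ}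

theorem level_lt_of_nextCube_eq_some (hE : volume E ≤ (2 ^ (d + 2) : ℝ≥0∞)⁻¹ * volume (dyadicSet Q))
    (h : nextCube E Q x = some P) : Q.1 < P.1 := by
  obtain ⟨hx, j, rfl, hj, -⟩ := nextCube_eq_some_iff.1 h
  -- The search for a child starts at `Q` itself, which is rejected since `E` has density at most
  -- 2^(-d-2) there.
  rcases Nat.eq_zero_or_pos j with rfl | hpos
  · exfalso
    simp only [Nat.cast_zero, add_zero, dyadicAt_fst_of_mem hx] at hj
    refine (hj.trans_le ((measure_mono Set.inter_subset_right).trans hE)).not_ge ?_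
    gcongr <;> simp
  · simp only [dyadicAt]; omega

/-- By maximality the parent of `P` was rejected, so |P ∩ E| ≤ 2^(-d-1) · 2^d |P| = |P|/2 and `P`
cannot lie inside `E`. -/
theorem exists_notMem_of_nextCube_eq_some
    (hE : volume E ≤ (2 ^ (d + 2) : ℝ≥0∞)⁻¹ * volume (dyadicSet Q))
    (h : nextCube E Q x = some P) : ∃ y ∈ dyadicSet P, y ∉ E := by
  by_contra! hPE
  have hlt := level_lt_of_nextCube_eq_some hE h
  obtain ⟨hx, j, rfl, hj, hi⟩ := nextCube_eq_some_iff.1 h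
  obtain ⟨i, rfl⟩ : ∃ i, j = i + 1 := Nat.exists_eq_add_one.2 (by simp [dyadicAt] at hlt; omega)
  have h1 := hi i (by omega)
  have h2 := volume_dyadicSet_parent (Q.1 + i) x
  have hsub : dyadicSet (dyadicAt (Q.1 + (i + 1 : ℕ)) x) ⊆
      dyadicSet (dyadicAt (Q.1 + i) x) ∩ E := fun y hy =>
    ⟨dyadicSet_subset (by simp [dyadicAt]) (self_mem_dyadicSet _ x) (self_mem_dyadicSet _ x) hy,
      hPE y hy⟩
  have h3 := (measure_mono hsub).trans h1
  rw [h2, pow_succ, ENNReal.mul_inv (by simp) (by simp)] at h3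
  rw [mul_comm _ (2 : ℝ≥0∞)⁻¹, mul_assoc, ← mul_assoc _ ((2 : ℝ≥0∞) ^ d),
    ENNReal.inv_mul_cancel (by simp) (by finiteness), one_mul] at h3
  have hcast : Q.1 + (i + 1 : ℕ) = Q.1 + i + 1 := by push_cast; ring
  rw [hcast] at h3
  have h4 := volume_dyadicSet_ne_zero (dyadicAt (Q.1 + i + 1) x)
  have h5 := volume_dyadicSet_ne_top (dyadicAt (Q.1 + i + 1) x)
  rw [← ENNReal.div_eq_inv_mul] at h3
  exact (ENNReal.half_lt_self h4 h5).not_ge h3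

/-- The children are disjoint and each has volume at most 2^(d+1) times its intersection with `E`.
Summation goes through `volume.restrict E`, since only the children, not `E`, are known to be
measurable. -/
theorem volume_nextCube_ne_none_le
    (hE : volume E ≤ (2 ^ (d + 2) : ℝ≥0∞)⁻¹ * volume (dyadicSet Q)) :
    volume {x | nextCube E Q x ≠ none} ≤ 2⁻¹ * volume (dyadicSet Q) := by
  have hS := nextCube_isSelection E Q
  have hU : {x | nextCube E Q x ≠ none} = ⋃ P, {x | nextCube E Q x = some P} := by
    ext x
    simp only [Set.mem_ofPred_eq, Set.mem_iUnion]
    exact Option.ne_none_iff_exists'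
  have hm : ∀ P, MeasurableSet {x | nextCube E Q x = some P} := fun P => hS.measurableSet_fiber _
  have hd : Pairwise (Function.onFun Disjoint fun P => {x | nextCube E Q x = some P}) :=
    fun P P' h => IsSelection.pairwise_disjoint_fiber _ ((Option.some_injective _).ne h)
  have key : ∀ P, volume {x | nextCube E Q x = some P} ≤
      2 ^ (d + 1) * (volume.restrict E) {x | nextCube E Q x = some P} := by
    intro P
    rcases Set.eq_empty_or_nonempty {x | nextCube E Q x = some P} with h | ⟨x, hx⟩
    · simp [h]
    · rw [hS.fiber_eq hx, Measure.restrict_apply (measurableSet_dyadicSet P)]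
      obtain ⟨-, j, rfl, hj, -⟩ := nextCube_eq_some_iff.1 hx
      rw [← ENNReal.inv_mul_le_iff (by simp) (by finiteness)]
      exact hj.le
  calc volume {x | nextCube E Q x ≠ none}
      = ∑' P, volume {x | nextCube E Q x = some P} := by rw [hU, measure_iUnion hd hm]
    _ ≤ ∑' P, 2 ^ (d + 1) * (volume.restrict E) {x | nextCube E Q x = some P} :=
        ENNReal.tsum_le_tsum key
    _ = 2 ^ (d + 1) * (volume.restrict E) (⋃ P, {x | nextCube E Q x = some P}) := by
        rw [ENNReal.tsum_mul_left, measure_iUnion hd hm]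
    _ ≤ 2 ^ (d + 1) * volume E := by
        refine mul_le_mul' le_rfl ?_
        exact (measure_mono (Set.subset_univ _)).trans (Measure.restrict_apply_univ E).le
    _ ≤ 2 ^ (d + 1) * ((2 ^ (d + 2) : ℝ≥0∞)⁻¹ * volume (dyadicSet Q)) := by gcongr
    _ = 2⁻¹ * volume (dyadicSet Q) := by
        have h2 : (2 ^ (d + 2) : ℝ≥0∞)⁻¹ = (2 ^ (d + 1))⁻¹ * 2⁻¹ := by
          rw [← ENNReal.mul_inv (Or.inr (by simp)) (Or.inr (by simp)), ← pow_succ]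
        rw [h2, ← mul_assoc, ← mul_assoc, ENNReal.mul_inv_cancel (by simp) (by finiteness), one_mul]

end Small

/-- Almost every point of `E` is a dyadic density point, so some small cube around it passes the
stopping test. -/
theorem ae_notMem_of_nextCube_eq_none (E : Set (Fin d → ℝ)) (Q : DyadicLabel d) :
    ∀ᵐ x, x ∈ dyadicSet Q → nextCube E Q x = none → x ∉ E := by
  have hc : (2 ^ (d + 1) : ℝ≥0∞)⁻¹ < 1 := by
    rw [ENNReal.inv_lt_one]
    exact one_lt_pow₀ (by norm_num) (by omega)
  filter_upwards [ae_imp_of_ae_restrict (ae_exists_dyadic_density E hc Q.1)] with x hx hxQ hn hxE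
  unfold nextCube at hn
  rw [dif_pos ⟨hxQ, hx hxE⟩] at hn
  exact absurd hn (by simp)

/-- The `k`-th generation stopping cube containing a given point, if there is one. -/
noncomputable def stoppingCube (E : DyadicLabel d → Set (Fin d → ℝ))
    (top : (Fin d → ℝ) → DyadicLabel d) : ℕ → (Fin d → ℝ) → Option (DyadicLabel d)
  | 0, x => some (top x)
  | k + 1, x => (stoppingCube E top k x).bind fun Q => nextCube (E Q) Q x

/-! ### Iteration of the stopping construction -/

section Stopping

variable {E : DyadicLabel d → Set (Fin d → ℝ)} {top : (Fin d → ℝ) → DyadicLabel d}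

theorem stoppingCube_succ_eq_some {k : ℕ} {x : Fin d → ℝ} {P : DyadicLabel d} :
    stoppingCube E top (k + 1) x = some P ↔
      ∃ Q, stoppingCube E top k x = some Q ∧ nextCube (E Q) Q x = some P :=
  Option.bind_eq_some_iff

theorem stoppingCube_eq_none_mono {j k : ℕ} (h : j ≤ k) {x : Fin d → ℝ}
    (hj : stoppingCube E top j x = none) : stoppingCube E top k x = none := by
  induction h with
  | refl => exact hj
  | step _ ih => simp [stoppingCube, ih]

variable (htop : IsSelection fun x => some (top x))
include htop

theorem stoppingCube_const_aux (k : ℕ) {x y : Fin d → ℝ} {Q : DyadicLabel d}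
    (hx : stoppingCube E top k x = some Q) (hy : y ∈ dyadicSet Q) :
    stoppingCube E top k y = some Q ∧ top y = top x := by
  induction k generalizing Q with
  | zero =>
    have h := htop.const hx hy
    exact ⟨h, Option.some_injective _ (h.trans hx.symm)⟩
  | succ k ih =>
    obtain ⟨R, hR, hn⟩ := stoppingCube_succ_eq_some.1 hx
    have hn' := (nextCube_isSelection _ _).const hn hy
    obtain ⟨h1, h2⟩ := ih hR (mem_of_nextCube_eq_some hn')
    exact ⟨stoppingCube_succ_eq_some.2 ⟨R, h1, hn'⟩, h2⟩

theorem stoppingCube_isSelection (k : ℕ) : IsSelection (stoppingCube E top k) where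
  mem := by
    intro x Q h
    cases k with
    | zero => exact htop.mem h
    | succ k =>
      obtain ⟨R, -, hn⟩ := stoppingCube_succ_eq_some.1 h
      exact (nextCube_isSelection _ _).mem hn
  const := fun hx hy => (stoppingCube_const_aux htop k hx hy).1

variable (hE : ∀ Q, volume (E Q) ≤ (2 ^ (d + 2) : ℝ≥0∞)⁻¹ * volume (dyadicSet Q))

omit htop in
include hE in
theorem stoppingCube_level_lt {j k : ℕ} (h : j < k) {x : Fin d → ℝ} {P Q : DyadicLabel d}
    (hj : stoppingCube E top j x = some Q) (hk : stoppingCube E top k x = some P) : Q.1 < P.1 := by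
  induction h generalizing P with
  | refl =>
    obtain ⟨R, hR, hn⟩ := stoppingCube_succ_eq_some.1 hk
    obtain rfl : Q = R := Option.some_injective _ (hj.symm.trans hR)
    exact level_lt_of_nextCube_eq_some (hE Q) hn
  | step _ ih =>
    obtain ⟨R, hR, hn⟩ := stoppingCube_succ_eq_some.1 hk
    exact (ih hR).trans (level_lt_of_nextCube_eq_some (hE R) hn)

include hE in
-- Levels strictly increase along generations, so a cube cannot recur; sums over generations
-- therefore count each stopping cube once.
theorem stoppingCube_generation_unique {j k : ℕ} {x y : Fin d → ℝ} {Q : DyadicLabel d}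
    (hj : stoppingCube E top j x = some Q) (hk : stoppingCube E top k y = some Q) : j = k := by
  have hk' := (stoppingCube_isSelection htop k).const hk
    ((stoppingCube_isSelection htop j).mem hj)
  rcases lt_trichotomy j k with h | h | h
  · exact absurd (stoppingCube_level_lt hE h hj hk') (lt_irrefl _)
  · exact h
  · exact absurd (stoppingCube_level_lt hE h hk' hj) (lt_irrefl _)

include hE in
theorem volume_stoppingCube_ne_none_le (R : DyadicLabel d) (k : ℕ) :
    volume {x | top x = R ∧ stoppingCube E top k x ≠ none} ≤ 2⁻¹ ^ k * volume (dyadicSet R) := by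
  induction k with
  | zero =>
    simp only [pow_zero, one_mul]
    refine measure_mono fun x hx => ?_
    exact htop.mem (congrArg some hx.1)
  | succ k ih =>
    have hS := stoppingCube_isSelection (E := E) htop k
    have hd : Pairwise (Function.onFun Disjoint
        fun Q => {x | top x = R ∧ stoppingCube E top k x = some Q}) := fun P P' h =>
      Set.disjoint_left.2 fun x hx hx' => h (Option.some_injective _ (hx.2.symm.trans hx'.2))
    have hm : ∀ Q, MeasurableSet {x | top x = R ∧ stoppingCube E top k x = some Q} := by
      intro Q
      have : {x | top x = R ∧ stoppingCube E top k x = some Q} =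
          {x | some (top x) = some R} ∩ {x | stoppingCube E top k x = some Q} := by
        ext x; simp
      rw [this]
      exact (htop.measurableSet_fiber _).inter (hS.measurableSet_fiber _)
    have hsub : {x | top x = R ∧ stoppingCube E top (k + 1) x ≠ none} ⊆
        ⋃ Q, {x | (top x = R ∧ stoppingCube E top k x = some Q) ∧ nextCube (E Q) Q x ≠ none} := by
      rintro x ⟨hx, hne⟩
      obtain ⟨P, hP⟩ := Option.ne_none_iff_exists'.1 hne
      obtain ⟨Q, hQ, hn⟩ := stoppingCube_succ_eq_some.1 hP
      exact Set.mem_iUnion.2 ⟨Q, ⟨hx, hQ⟩, by rw [hn]; simp⟩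
    have key : ∀ Q, volume {x | (top x = R ∧ stoppingCube E top k x = some Q) ∧
        nextCube (E Q) Q x ≠ none} ≤
        2⁻¹ * volume {x | top x = R ∧ stoppingCube E top k x = some Q} := by
      intro Q
      rcases Set.eq_empty_or_nonempty {x | top x = R ∧ stoppingCube E top k x = some Q}
        with h | ⟨x, hx⟩
      · refine (measure_mono_null (fun y hy => ?_) (measure_empty (μ := volume))).le.trans zero_le
        exact h.subset hy.1
      · calc _ ≤ volume {x | nextCube (E Q) Q x ≠ none} := measure_mono fun y hy => hy.2
          _ ≤ 2⁻¹ * volume (dyadicSet Q) := volume_nextCube_ne_none_le (hE Q)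
          _ ≤ _ := by
            gcongr
            intro y hy
            obtain ⟨h1, h2⟩ := stoppingCube_const_aux htop k hx.2 hy
            exact ⟨h2.trans hx.1, h1⟩
    calc _ ≤ ∑' Q, volume {x | (top x = R ∧ stoppingCube E top k x = some Q) ∧
        nextCube (E Q) Q x ≠ none} := (measure_mono hsub).trans (measure_iUnion_le _)
      _ ≤ ∑' Q, 2⁻¹ * volume {x | top x = R ∧ stoppingCube E top k x = some Q} :=
        ENNReal.tsum_le_tsum key
      _ = 2⁻¹ * volume (⋃ Q, {x | top x = R ∧ stoppingCube E top k x = some Q}) := by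
        rw [ENNReal.tsum_mul_left, measure_iUnion hd hm]
      _ ≤ 2⁻¹ * volume {x | top x = R ∧ stoppingCube E top k x ≠ none} := by
        gcongr
        refine Set.iUnion_subset fun Q x hx => ⟨hx.1, ?_⟩
        rw [hx.2]; simp
      _ ≤ 2⁻¹ * (2⁻¹ ^ k * volume (dyadicSet R)) := by gcongr
      _ = _ := by rw [pow_succ', mul_assoc]

include hE in
-- Inside each of the countably many top cubes, the k-th generation occupies at most a fraction
-- 2^(-k).
theorem ae_exists_stoppingCube_eq_none : ∀ᵐ x, ∃ k, stoppingCube E top k x = none := by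
  have h : ∀ R, volume {x | top x = R ∧ ∀ k, stoppingCube E top k x ≠ none} = 0 := by
    intro R
    have hlim : Filter.Tendsto (fun k : ℕ => (2⁻¹ : ℝ≥0∞) ^ k * volume (dyadicSet R)) Filter.atTop
        (nhds 0) := by
      have := ENNReal.Tendsto.mul_const (b := volume (dyadicSet R))
        (ENNReal.tendsto_pow_atTop_nhds_zero_of_lt_one (r := 2⁻¹) (by simp))
        (Or.inr (volume_dyadicSet_ne_top R))
      simpa using this
    refine le_antisymm (ge_of_tendsto' hlim fun k => ?_) zero_le
    refine le_trans (measure_mono ?_) (volume_stoppingCube_ne_none_le htop hE R k)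
    exact fun x hx => ⟨hx.1, hx.2 k⟩
  rw [ae_iff]
  refine measure_mono_null (fun x hx => ?_) (measure_iUnion_null h)
  simp only [not_exists] at hx
  exact Set.mem_iUnion.2 ⟨top x, rfl, hx⟩

end Stopping

end Selection

/-! ### Top cubes -/

section Top

variable {d : ℕ}

theorem exists_centralIndex (N : ℕ) (x : Fin d → ℝ) :
    ∃ m : ℕ, N ≤ m ∧ ∀ i, dyadicIndex (-(m : ℤ)) x i = -1 ∨ dyadicIndex (-(m : ℤ)) x i = 0 := by
  obtain ⟨m₀, hm₀⟩ := pow_unbounded_of_one_lt ‖x‖ (one_lt_two)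
  refine ⟨max N m₀, le_max_left _ _, fun i => ?_⟩
  set m := max N m₀
  have h2 : (2 : ℝ) ^ m₀ ≤ 2 ^ m := pow_le_pow_right₀ one_le_two (le_max_right _ _)
  have hx : |x i| < 2 ^ m := ((norm_le_pi_norm x i).trans_lt hm₀).trans_le h2
  have hpos : (0 : ℝ) < 2 ^ m := by positivity
  obtain ⟨hx1, hx2⟩ := abs_lt.1 hx
  simp only [dyadicIndex, zpow_neg, zpow_natCast, Int.floor_eq_iff, ← div_eq_inv_mul]
  rcases lt_or_ge (x i) 0 with h | h
  · left
    rw [le_div_iff₀ hpos, div_lt_iff₀ hpos]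
    constructor <;> push_cast <;> linarith
  · right
    rw [le_div_iff₀ hpos, div_lt_iff₀ hpos]
    constructor <;> push_cast <;> linarith

open Classical in
/-- The least `m ≥ N` such that `x` lies in the cube `[-2 ^ m, 2 ^ m) ^ d`. -/
noncomputable def centralIndex (N : ℕ) (x : Fin d → ℝ) : ℕ := Nat.find (exists_centralIndex N x)

/-- The dyadic cubes forming the partition of the space into the dyadic halves of
`[-2 ^ N, 2 ^ N) ^ d` and of the annuli `[-2 ^ m, 2 ^ m) ^ d ∖ [-2 ^ (m-1), 2 ^ (m-1)) ^ d`. -/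
noncomputable def topCube (N : ℕ) (x : Fin d → ℝ) : DyadicLabel d :=
  dyadicAt (1 - (centralIndex N x : ℤ)) x

theorem topCube_isSelection (N : ℕ) :
    IsSelection fun x : Fin d → ℝ => some (topCube N x) where
  mem := by
    intro x Q h
    obtain rfl := Option.some_injective _ h
    exact self_mem_dyadicSet _ x
  const := by
    classical
    intro x Q y h hy
    obtain rfl := Option.some_injective _ h
    have hy' : dyadicIndex (1 - (centralIndex N x : ℤ)) y =
      dyadicIndex (1 - (centralIndex N x : ℤ)) x := hy
    have hm : centralIndex N y = centralIndex N x := by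
      refine (Nat.find_eq_iff _).2 ⟨?_, ?_⟩
      · have h := Nat.find_spec (exists_centralIndex N x)
        rw [dyadicIndex_eq_of_le (by omega) hy']
        exact h
      · rintro m hlt ⟨hNm, hi⟩
        obtain ⟨j, hj⟩ := Nat.exists_eq_add_of_lt hlt
        -- Being central persists at coarser levels, as floor division by 2^j fixes −1 and 0. If `y`
        -- were central too early, it would be so one step before the index of `x`, which is the
        -- level of the common cube; then so would `x`, against minimality.
        refine Nat.find_min (exists_centralIndex N x) (m := m + j)
          (by change m + j < centralIndex N x; omega) ⟨by omega, fun i => ?_⟩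
        have h1 : (-((m + j : ℕ) : ℤ)) = 1 - (centralIndex N x : ℤ) := by rw [hj]; push_cast; ring
        have h2 : (-((m + j : ℕ) : ℤ)) = -(m : ℤ) - j := by push_cast; ring
        rw [h1, ← hy', ← h1, h2, dyadicIndex_sub_nat]
        rcases hi i with h | h
        · left
          rw [h, Int.neg_one_ediv]
          simp [Int.sign_eq_one_of_pos]
        · right
          simp [h]
    change some (topCube N y) = some (topCube N x)
    unfold topCube
    rw [hm]
    unfold dyadicAt
    rw [hy']

theorem closedBall_subset_dyadicNine_topCube (N : ℕ) (x : Fin d → ℝ) :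
    Metric.closedBall 0 (2 ^ N) ⊆ (dyadicNine (topCube N x)).toSet := by
  classical
  intro y hy i
  obtain ⟨hN, hi⟩ : N ≤ centralIndex N x ∧ ∀ i, dyadicIndex (-(centralIndex N x : ℤ)) x i = -1 ∨
      dyadicIndex (-(centralIndex N x : ℤ)) x i = 0 := Nat.find_spec (exists_centralIndex N x)
  have hyi : |y i| ≤ 2 ^ N := (norm_le_pi_norm y i).trans (by simpa using hy)
  have hc : |x i - (dyadicCube (topCube N x)).center i| ≤ _ :=
    dyadicSet_subset_dyadicCube _ (self_mem_dyadicSet (1 - (centralIndex N x : ℤ)) x) i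
  change _ ≤ (dyadicCube (topCube N x)).side / 2 at hc
  have hside : (dyadicCube (topCube N x)).side = 2 ^ centralIndex N x / 2 := by
    simp only [dyadicCube, topCube, dyadicAt]
    rw [neg_sub, zpow_sub₀ (by norm_num)]
    simp
  have hpow : (2 : ℝ) ^ N ≤ 2 ^ centralIndex N x := pow_le_pow_right₀ one_le_two hN
  have hpos : (0 : ℝ) < 2 ^ centralIndex N x := by positivity
  have hx : |x i| ≤ 2 ^ centralIndex N x := by
    have h := hi i
    simp only [dyadicIndex, zpow_neg, zpow_natCast, Int.floor_eq_iff, ← div_eq_inv_mul] at h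
    rw [le_div_iff₀ hpos, div_lt_iff₀ hpos, le_div_iff₀ hpos, div_lt_iff₀ hpos] at h
    push_cast at h
    rw [abs_le]
    rcases h with h | h <;> constructor <;> linarith
  change |y i - (dyadicCube (topCube N x)).center i| ≤ 3 * (3 * (dyadicCube (topCube N x)).side) / 2
  rw [hside] at hc ⊢
  -- With m the central index, |y − c| ≤ 2^N + 2^m + 2^m/4 ≤ (9/4) 2^m, exactly half the side of the
  -- ninefold cube: this is what fixes the dilation 9 here.
  rw [abs_le] at *
  constructor <;> linarith

end Top

/-! ### Sparse domination of sums over stopping cubes -/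

section Domination

variable {d : ℕ} {E : DyadicLabel d → Set (Fin d → ℝ)} {top : (Fin d → ℝ) → DyadicLabel d}

/-- The set of all stopping cubes. -/
def stoppingFamily (E : DyadicLabel d → Set (Fin d → ℝ)) (top : (Fin d → ℝ) → DyadicLabel d) :
    Set (DyadicLabel d) := {Q | ∃ k x, stoppingCube E top k x = some Q}

/-- The witness for 9Q is `Q` minus its children, of volume at least |Q|/2. A point of it has the
generation of `Q` as its last one, so the point determines `Q`; this gives disjointness. -/
theorem stoppingFamily_isSparse (htop : IsSelection fun x => some (top x))
    (hE : ∀ Q, volume (E Q) ≤ (2 ^ (d + 2) : ℝ≥0∞)⁻¹ * volume (dyadicSet Q)) :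
    IsSparse (1 / 2 * (1 / 9 ^ d)) (dyadicNine '' stoppingFamily E top) := by
  have hinv : ∀ Q : DyadicLabel d, Function.invFun dyadicNine (dyadicNine Q) = Q :=
    Function.leftInverse_invFun dyadicNine_injective
  refine ⟨fun C => dyadicSet (Function.invFun dyadicNine C) ∩
    {x | nextCube (E (Function.invFun dyadicNine C)) (Function.invFun dyadicNine C) x = none},
    ?_, ?_⟩
  · rintro _ ⟨Q, -, rfl⟩
    simp only [hinv]
    have hm := (nextCube_isSelection (E Q) Q).measurableSet_fiber none
    refine ⟨(measurableSet_dyadicSet Q).inter hm,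
      Set.inter_subset_left.trans (dyadicSet_subset_dyadicNine Q), ?_⟩
    have h1 : volume (dyadicSet Q) ≤
        volume (dyadicSet Q ∩ {x | nextCube (E Q) Q x = none}) + 2⁻¹ * volume (dyadicSet Q) := by
      rw [← measure_inter_add_sdiff (dyadicSet Q) hm]
      gcongr
      rw [measure_inter_add_sdiff (dyadicSet Q) hm]
      exact (measure_mono fun x hx => hx.2).trans (volume_nextCube_ne_none_le (hE Q))
    rw [volume_dyadicNine]
    have hη : ENNReal.ofReal (1 / 2 * (1 / 9 ^ d)) * (9 ^ d * volume (dyadicSet Q)) =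
        2⁻¹ * volume (dyadicSet Q) := by
      rw [ENNReal.ofReal_mul (by norm_num), ← mul_assoc, mul_assoc (ENNReal.ofReal _)]
      have : ENNReal.ofReal (1 / 9 ^ d) * 9 ^ d = 1 := by
        rw [one_div, ENNReal.ofReal_inv_of_pos (by positivity), ENNReal.ofReal_pow (by norm_num)]
        simp only [ENNReal.ofReal_ofNat]
        exact ENNReal.inv_mul_cancel (by simp) (by finiteness)
      rw [this, mul_one, one_div, ENNReal.ofReal_inv_of_pos (by norm_num)]
      simp
    rw [hη]
    have hfin : 2⁻¹ * volume (dyadicSet Q) ≠ ∞ :=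
      ENNReal.mul_ne_top (by simp) (volume_dyadicSet_ne_top Q)
    refine (ENNReal.add_le_add_iff_right hfin).1 ?_
    rwa [← add_mul, ENNReal.inv_two_add_inv_two, one_mul]
  · rintro _ ⟨Q, ⟨k, z, hz⟩, rfl⟩ _ ⟨P, ⟨l, w, hw⟩, rfl⟩ hne
    refine Set.disjoint_left.2 fun x hx hx' => hne ?_
    simp only [hinv] at hx hx'
    have hk := (stoppingCube_isSelection htop k).const hz hx.1
    have hl := (stoppingCube_isSelection htop l).const hw hx'.1
    have hk1 : stoppingCube E top (k + 1) x = none := by simpa [stoppingCube, hk] using hx.2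
    have hl1 : stoppingCube E top (l + 1) x = none := by simpa [stoppingCube, hl] using hx'.2
    have h1 : l ≤ k := by
      by_contra! h
      rw [stoppingCube_eq_none_mono h hk1] at hl
      exact absurd hl (by simp)
    have h2 : k ≤ l := by
      by_contra! h
      rw [stoppingCube_eq_none_mono h hl1] at hk
      exact absurd hk (by simp)
    obtain rfl := le_antisymm h1 h2
    rw [Option.some_injective _ (hk.symm.trans hl)]

theorem lintegral_tsum_stoppingCube_le (htop : IsSelection fun x => some (top x))
    (hE : ∀ Q, volume (E Q) ≤ (2 ^ (d + 2) : ℝ≥0∞)⁻¹ * volume (dyadicSet Q))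
    {Φ : DyadicLabel d → (Fin d → ℝ) → ℝ≥0∞} {w : DyadicLabel d → ℝ≥0∞}
    (hm : ∀ Q, AEMeasurable (Φ Q)) (hΦ : ∀ Q, ∫⁻ x in dyadicSet Q, Φ Q x ≤ w Q) :
    ∫⁻ x, ∑' k, (stoppingCube E top k x).elim 0 (Φ · x) ≤
      ∑' Q : stoppingFamily E top, w Q := by
  have hS := stoppingCube_isSelection (E := E) htop
  rw [lintegral_tsum fun k => (hS k).aemeasurable_comp (V := fun o x => o.elim 0 (Φ · x))
    (by rintro (_ | Q); exacts [aemeasurable_const, hm Q])]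
  have h1 : ∀ k, ∫⁻ x, (stoppingCube E top k x).elim 0 (Φ · x) ≤
      ∑' Q, {Q | ∃ x, stoppingCube E top k x = some Q}.indicator w Q := by
    intro k
    have h0 : ∫⁻ x in {x | stoppingCube E top k x = none},
        (stoppingCube E top k x).elim 0 (Φ · x) = 0 := by
      rw [setLIntegral_congr_fun ((hS k).measurableSet_fiber none) (g := fun _ => 0)]
      · simp
      · intro x hx
        simp only [show stoppingCube E top k x = none from hx, Option.elim]
    rw [(hS k).lintegral_eq_tsum, ← (Option.some_injective _).tsum_eq]
    swap
    · rintro (_ | Q) ho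
      · exact absurd h0 ho
      · exact ⟨Q, rfl⟩
    refine ENNReal.tsum_le_tsum fun Q => ?_
    rcases Set.eq_empty_or_nonempty {x | stoppingCube E top k x = some Q} with h | ⟨z, hz⟩
    · simp [h]
    · rw [Set.indicator_of_mem (show Q ∈ {Q | ∃ x, stoppingCube E top k x = some Q} from ⟨z, hz⟩)]
      rw [setLIntegral_congr_fun ((hS k).measurableSet_fiber (some Q)) (g := Φ Q)]
      · rw [(hS k).fiber_eq hz]
        exact hΦ Q
      · intro x hx
        simp only [show stoppingCube E top k x = some Q from hx, Option.elim]
  refine (ENNReal.tsum_le_tsum h1).trans ?_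
  rw [ENNReal.tsum_comm, tsum_subtype]
  refine ENNReal.tsum_le_tsum fun Q => ?_
  by_cases hQ : Q ∈ stoppingFamily E top
  · obtain ⟨k, z, hz⟩ := hQ
    rw [tsum_eq_single k]
    · rw [Set.indicator_of_mem (show Q ∈ stoppingFamily E top from ⟨k, z, hz⟩)]
      exact Set.indicator_le_self' (fun _ _ => zero_le) Q
    · rintro j hj
      refine Set.indicator_of_notMem ?_ _
      rintro ⟨y, hy⟩
      exact hj (stoppingCube_generation_unique htop hE hy hz)
  · refine (ENNReal.tsum_eq_zero.2 fun k => Set.indicator_of_notMem ?_ _).le.trans zero_le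
    rintro ⟨y, hy⟩
    exact hQ ⟨k, y, hy⟩

/-- Hölder on `Q`, followed by enlarging both factors to 9Q, where the powers of the volume
recombine to exponent 1. -/
theorem lintegral_mul_enorm_le_avgLp {𝕜 : Type*} [RCLike 𝕜] {q r : ℝ} (hqr : q.HolderConjugate r)
    {Q : DyadicLabel d} {φ : (Fin d → ℝ) → ℝ≥0∞} (hφ : AEMeasurable φ) {g : (Fin d → ℝ) → 𝕜}
    (hg : AEStronglyMeasurable g volume) {κ : ℝ≥0∞}
    (h : ∫⁻ x in dyadicSet Q, φ x ^ q ≤ κ ^ q * volume (dyadicSet Q)) :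
    ∫⁻ x in dyadicSet Q, φ x * ‖g x‖ₑ ≤
      κ * (volume (dyadicNine Q).toSet * avgLp r (dyadicNine Q) g) := by
  have hq := hqr.pos
  have hr := hqr.symm.pos
  have hsub := dyadicSet_subset_dyadicNine Q
  set v := volume (dyadicNine Q).toSet with hv
  have hv0 : v ≠ 0 := Cube.volume_toSet_ne_zero _
  have hvt : v ≠ ∞ := Cube.volume_toSet_ne_top _
  set I := ∫⁻ x in (dyadicNine Q).toSet, ‖g x‖ₑ ^ r with hI
  calc ∫⁻ x in dyadicSet Q, φ x * ‖g x‖ₑ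
      ≤ (∫⁻ x in dyadicSet Q, φ x ^ q) ^ (1 / q) * (∫⁻ x in dyadicSet Q, ‖g x‖ₑ ^ r) ^ (1 / r) :=
        ENNReal.lintegral_mul_le_Lp_mul_Lq _ hqr hφ.restrict hg.enorm.restrict
    _ ≤ (κ ^ q * v) ^ (1 / q) * I ^ (1 / r) := by
        gcongr
        · exact h.trans (mul_le_mul' le_rfl (measure_mono hsub))
        · exact lintegral_mono_set hsub
    _ = κ * (v ^ (1 / q) * I ^ (1 / r)) := by
        rw [ENNReal.mul_rpow_of_nonneg _ _ (by positivity), ← ENNReal.rpow_mul,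
          mul_one_div_cancel hq.ne', ENNReal.rpow_one, mul_assoc]
    _ = κ * (v ^ (1 / q) * (v * (v⁻¹ * I)) ^ (1 / r)) := by
        rw [← mul_assoc v, ENNReal.mul_inv_cancel hv0 hvt, one_mul]
    _ = κ * (v ^ (1 / q) * v ^ (1 / r) * (v⁻¹ * I) ^ (1 / r)) := by
        rw [ENNReal.mul_rpow_of_nonneg _ _ (by positivity : (0 : ℝ) ≤ 1 / r), mul_assoc]
    _ = κ * (v * avgLp r (dyadicNine Q) g) := by
        rw [← ENNReal.rpow_add _ _ hv0 hvt, one_div, one_div, hqr.inv_add_inv_eq_one,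
          ENNReal.rpow_one, avgLp, one_div]

theorem lintegral_stoppingCube_le_sparseForm {𝕜 : Type*} [RCLike 𝕜]
    (htop : IsSelection fun x => some (top x))
    (hE : ∀ Q, volume (E Q) ≤ (2 ^ (d + 2) : ℝ≥0∞)⁻¹ * volume (dyadicSet Q))
    {q r β : ℝ} (hqr : q.HolderConjugate r) {φ : DyadicLabel d → (Fin d → ℝ) → ℝ≥0∞}
    (hφ : ∀ Q, AEMeasurable (φ Q)) {f g : (Fin d → ℝ) → 𝕜} (hg : AEStronglyMeasurable g volume)
    {B : ℝ≥0∞} (h : ∀ Q, ∫⁻ x in dyadicSet Q, φ Q x ^ q ≤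
      (B * normLLogL β (dyadicNine Q) f) ^ q * volume (dyadicSet Q)) :
    ∫⁻ x, (∑' k, (stoppingCube E top k x).elim 0 (φ · x)) * ‖g x‖ₑ ≤
      B * sparseForm (dyadicNine '' stoppingFamily E top) β r f g := by
  have h1 : ∀ x, (∑' k, (stoppingCube E top k x).elim 0 (φ · x)) * ‖g x‖ₑ =
      ∑' k, (stoppingCube E top k x).elim 0 (fun Q => φ Q x * ‖g x‖ₑ) := by
    intro x
    rw [← ENNReal.tsum_mul_right]
    congr 1
    ext k
    cases stoppingCube E top k x <;> simp
  simp_rw [h1]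
  refine (lintegral_tsum_stoppingCube_le htop hE (fun Q => (hφ Q).mul hg.enorm)
    (fun Q => lintegral_mul_enorm_le_avgLp hqr (hφ Q) hg (h Q))).trans (le_of_eq ?_)
  rw [sparseForm, tsum_image (fun C : Cube d => volume C.toSet * normLLogL β C f * avgLp r C g)
    dyadicNine_injective.injOn, ← ENNReal.tsum_mul_left]
  congr 1
  ext Q
  ring

end Domination

/-! ### The Luxemburg norm and the weak type bound on a cube -/

section Young

theorem one_le_log_exp_add {u : ℝ} (hu : 0 ≤ u) : 1 ≤ Real.log (Real.exp 1 + u) := by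
  rw [Real.le_log_iff_exp_le (by positivity)]
  linarith

theorem youngLog_zero (β : ℝ) : youngLog β 0 = 0 := by simp [youngLog]

theorem log_rpow_mono {β u v : ℝ} (hβ : 0 ≤ β) (hu : 0 ≤ u) (huv : u ≤ v) :
    Real.log (Real.exp 1 + u) ^ β ≤ Real.log (Real.exp 1 + v) ^ β := by
  have := one_le_log_exp_add hu
  gcongr

theorem youngLog_mono {β u v : ℝ} (hβ : 0 ≤ β) (hu : 0 ≤ u) (huv : u ≤ v) :
    youngLog β u ≤ youngLog β v :=
  mul_le_mul huv (log_rpow_mono hβ hu huv)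
    (Real.rpow_nonneg (zero_le_one.trans (one_le_log_exp_add hu)) _) (hu.trans huv)

theorem youngLog_div_le {β u D : ℝ} (hβ : 0 ≤ β) (hu : 0 ≤ u) (hD : 1 ≤ D) :
    youngLog β (u / D) ≤ D⁻¹ * youngLog β u := by
  have hD0 : 0 < D := by linarith
  unfold youngLog
  rw [div_eq_inv_mul, mul_assoc]
  have h := log_rpow_mono hβ (u := D⁻¹ * u) (by positivity)
    (mul_le_of_le_one_left hu (inv_le_one_of_one_le₀ hD))
  gcongr

variable {d : ℕ} {𝕜 : Type*} [RCLike 𝕜] {β : ℝ} {Q : Cube d} {f : (Fin d → ℝ) → 𝕜}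

theorem setLIntegral_youngLog_le_of_normLLogL_lt (hβ : 0 ≤ β) {s : ℝ}
    (h : normLLogL β Q f < ENNReal.ofReal s) :
    ∫⁻ x in Q.toSet, ENNReal.ofReal (youngLog β (‖f x‖ / s)) ≤ volume Q.toSet := by
  simp only [normLLogL, iInf_lt_iff] at h
  obtain ⟨t, ht, hle, hts⟩ := h
  have hts' : t < s := (ENNReal.ofReal_lt_ofReal_iff_of_nonneg ht.le).1 hts
  rw [ENNReal.inv_mul_le_iff Q.volume_toSet_ne_zero Q.volume_toSet_ne_top, mul_one] at hle
  refine (lintegral_mono fun x => ENNReal.ofReal_le_ofReal ?_).trans hle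
  have := ht.trans hts'
  exact youngLog_mono hβ (by positivity) (by gcongr)

theorem normLLogL_ne_top (hβ : 0 ≤ β) {M : ℝ} (hf : ∀ᵐ x, ‖f x‖ ≤ M) :
    normLLogL β Q f ≠ ∞ := by
  set L := Real.log (Real.exp 1 + 1) ^ β with hL
  have hL1 : 1 ≤ L := Real.one_le_rpow (one_le_log_exp_add zero_le_one) hβ
  have ht : 0 < max M 1 * L := by positivity
  refine ne_top_of_le_ne_top ENNReal.ofReal_ne_top
    (iInf₂_le_of_le (max M 1 * L) ht (iInf_le_of_le ?_ le_rfl))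
  rw [ENNReal.inv_mul_le_iff Q.volume_toSet_ne_zero Q.volume_toSet_ne_top, mul_one]
  have h1 : ∀ᵐ x ∂(volume.restrict Q.toSet),
      ENNReal.ofReal (youngLog β (‖f x‖ / (max M 1 * L))) ≤ 1 := by
    filter_upwards [ae_restrict_of_ae hf] with x hx
    have hu : ‖f x‖ / (max M 1 * L) ≤ L⁻¹ := by
      rw [div_le_iff₀ ht, mul_comm, mul_assoc, mul_inv_cancel₀ (by positivity), mul_one]
      exact hx.trans (le_max_left _ _)
    rw [ENNReal.ofReal_le_one]
    calc _ ≤ youngLog β L⁻¹ := youngLog_mono hβ (by positivity) hu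
      _ ≤ L⁻¹ * L := by
        unfold youngLog
        have := log_rpow_mono hβ (u := L⁻¹) (by positivity) (inv_le_one_of_one_le₀ hL1)
        gcongr
      _ = 1 := inv_mul_cancel₀ (by positivity)
  calc _ ≤ ∫⁻ x in Q.toSet, 1 := lintegral_mono_ae h1
    _ = _ := by simp

/-- Raising the threshold by the factor `D` gains `D⁻¹`, because Φ(u/D) ≤ Φ(u)/D for the Young
function Φ; at heights above the Luxemburg norm the remaining integral is at most |Q|. -/
theorem WeakLLogL.volume_lt_le {U : MeasFun d 𝕜 → (Fin d → ℝ) → ℝ≥0∞} {A K D : ℝ}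
    (hU : WeakLLogL U β A K) (hβ : 0 ≤ β) (hA : 0 ≤ A) (hD : 1 ≤ D) {h : MeasFun d 𝕜}
    (hh : IsBddCompactSupp h) (hfh : h =ᵐ[volume] Q.toSet.indicator f)
    (hN : normLLogL β Q f ≠ ∞) :
    volume {x | ENNReal.ofReal (D * A) * normLLogL β Q f < U h x} ≤
      ENNReal.ofReal K * (ENNReal.ofReal D⁻¹ * volume Q.toSet) := by
  have hD0 : 0 < D := by linarith
  set N := (normLLogL β Q f).toReal with hNdef
  have hNeq : normLLogL β Q f = ENNReal.ofReal N := (ENNReal.ofReal_toReal hN).symm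
  have hN0 : 0 ≤ N := ENNReal.toReal_nonneg
  have key : ∀ t, D * A * N < t → volume {x | ENNReal.ofReal t < U h x} ≤
      ENNReal.ofReal K * (ENNReal.ofReal D⁻¹ * volume Q.toSet) := by
    intro t ht
    have ht0 : 0 < t := lt_of_le_of_lt (by positivity) ht
    refine (hU h hh t ht0).trans ?_
    gcongr
    have h1 : ∫⁻ x, ENNReal.ofReal (youngLog β (A * ‖h x‖ / t)) =
        ∫⁻ x in Q.toSet, ENNReal.ofReal (youngLog β (A * ‖f x‖ / t)) := by
      rw [← lintegral_indicator Q.measurableSet_toSet]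
      refine lintegral_congr_ae ?_
      filter_upwards [hfh] with x hx
      by_cases hxQ : x ∈ Q.toSet <;> simp [hx, hxQ, youngLog_zero]
    rw [h1]
    rcases hA.eq_or_lt with rfl | hA0
    · simp [youngLog_zero]
    · have hs : N < t / (D * A) := by
        rw [lt_div_iff₀ (by positivity)]; linarith
      have h2 := setLIntegral_youngLog_le_of_normLLogL_lt hβ (f := f) (Q := Q) (s := t / (D * A))
        (by rw [hNeq]; exact (ENNReal.ofReal_lt_ofReal_iff_of_nonneg hN0).2 hs)
      calc _ ≤ ∫⁻ x in Q.toSet, ENNReal.ofReal D⁻¹ *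
            ENNReal.ofReal (youngLog β (‖f x‖ / (t / (D * A)))) := by
            refine lintegral_mono fun x => ?_
            rw [← ENNReal.ofReal_mul (by positivity)]
            refine ENNReal.ofReal_le_ofReal ?_
            have : A * ‖f x‖ / t = (‖f x‖ / (t / (D * A))) / D := by
              field_simp
            rw [this]
            exact youngLog_div_le hβ (by positivity) hD
        _ = ENNReal.ofReal D⁻¹ * ∫⁻ x in Q.toSet,
            ENNReal.ofReal (youngLog β (‖f x‖ / (t / (D * A)))) :=
            lintegral_const_mul' _ _ ENNReal.ofReal_ne_top
        _ ≤ _ := by gcongr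
  -- The norm may vanish or fail to be admissible, so the bound is proved at strictly larger heights
  -- and passed to the limit along increasing sets, for which no measurability is needed.
  have hset : {x | ENNReal.ofReal (D * A) * normLLogL β Q f < U h x} =
      ⋃ n : ℕ, {x | ENNReal.ofReal (D * A * N + 1 / ((n : ℝ) + 1)) < U h x} := by
    rw [hNeq, ← ENNReal.ofReal_mul (by positivity)]
    ext x
    simp only [Set.mem_ofPred_eq, Set.mem_iUnion]
    constructor
    · intro hx
      have hlim : Filter.Tendsto (fun n : ℕ => ENNReal.ofReal (D * A * N + 1 / ((n : ℝ) + 1)))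
          Filter.atTop (nhds (ENNReal.ofReal (D * A * N))) := by
        refine ENNReal.tendsto_ofReal ?_
        simpa using tendsto_one_div_add_atTop_nhds_zero_nat.const_add (D * A * N)
      exact (hlim.eventually_lt_const hx).exists
    · rintro ⟨n, hn⟩
      refine lt_of_le_of_lt (ENNReal.ofReal_le_ofReal ?_) hn
      have : (0 : ℝ) < 1 / ((n : ℝ) + 1) := by positivity
      linarith
  rw [hset, Directed.measure_iUnion]
  · refine iSup_le fun n => key _ ?_
    have : (0 : ℝ) < 1 / ((n : ℝ) + 1) := by positivity
    linarith
  · refine directed_of_isDirected_le fun m n hmn x hx => ?_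
    refine lt_of_le_of_lt (ENNReal.ofReal_le_ofReal ?_) hx
    gcongr

end Young

/-! ### Summation over the stopping cubes -/

section Telescoping

variable {d : ℕ} {𝕜 : Type*} [RCLike 𝕜]

theorem AEMeasurable.tsum_eventually_zero {h : ℕ → (Fin d → ℝ) → 𝕜} (hm : ∀ k, AEMeasurable (h k))
    (h0 : ∀ᵐ x, ∃ K, ∀ k ≥ K, h k x = 0) : AEStronglyMeasurable (fun x => ∑' k, h k x) := by
  refine aestronglyMeasurable_of_tendsto_ae Filter.atTop
    (f := fun n x => ∑ k ∈ Finset.range n, h k x) (fun n => ?_) ?_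
  · exact (Finset.aemeasurable_fun_sum _ fun k _ => hm k).aestronglyMeasurable
  · filter_upwards [h0] with x ⟨K, hK⟩
    have : Summable fun k => h k x := summable_of_ne_finset_zero (s := Finset.range K)
      fun k hk => hK k (by simpa using hk)
    exact this.hasSum.tendsto_sum_nat

theorem enorm_tsum_le_of_eventually_zero {h : ℕ → 𝕜} {K : ℕ} (hK : ∀ k ≥ K, h k = 0) :
    ‖∑' k, h k‖ₑ ≤ ∑' k, ‖h k‖ₑ := by
  rw [tsum_eq_sum (s := Finset.range K) fun k hk => hK k (by simpa using hk)]
  exact (enorm_sum_le _ _).trans (ENNReal.sum_le_tsum _)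

variable {E : DyadicLabel d → Set (Fin d → ℝ)}

theorem lintegral_nextCube_rpow_le {q : ℝ} (hq : 0 ≤ q) {Q : DyadicLabel d} {u : (Fin d → ℝ) → 𝕜}
    {v : DyadicLabel d → (Fin d → ℝ) → 𝕜} {κ : ℝ≥0∞}
    (hu : ∀ᵐ x, x ∈ dyadicSet Q → nextCube (E Q) Q x = none → ‖u x‖ₑ ≤ κ)
    (hv : ∀ P x, nextCube (E Q) Q x = some P →
      ∫⁻ y in dyadicSet P, ‖v P y‖ₑ ^ q ≤ κ ^ q * volume (dyadicSet P)) :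
    ∫⁻ x in dyadicSet Q, ‖(nextCube (E Q) Q x).elim (u x) (v · x)‖ₑ ^ q ≤
      κ ^ q * volume (dyadicSet Q) := by
  have hS := nextCube_isSelection (E Q) Q
  refine hS.lintegral_comp_le (V := fun o x => ‖o.elim (u x) (v · x)‖ₑ ^ q) ?_
  rintro (_ | P)
  · rw [← setLIntegral_const]
    refine setLIntegral_mono_ae' ((hS.measurableSet_fiber _).inter (measurableSet_dyadicSet Q)) ?_
    filter_upwards [hu] with x hx hmem
    exact ENNReal.rpow_le_rpow (hx hmem.2 hmem.1) hq
  · rcases Set.eq_empty_or_nonempty {x | nextCube (E Q) Q x = some P} with h | ⟨z, hz⟩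
    · simp [h]
    · have hsub : {x | nextCube (E Q) Q x = some P} ∩ dyadicSet Q = dyadicSet P := by
        rw [hS.fiber_eq hz]
        exact Set.inter_eq_left.2 fun x hx => mem_of_nextCube_eq_some (hS.const hz hx)
      rw [hsub]
      exact hv P z hz

variable {top : (Fin d → ℝ) → DyadicLabel d}

/-- Telescoping of `hstep` along the stopping cubes of a point. `G` is kept only at the last cube;
`a` and `b` are collected in `H₁`, and `c` in `H₂`. The factor 2 counts the two families, `ψ` and
`b`. -/
theorem exists_decomposition_of_stoppingCube (htop : IsSelection fun x => some (top x))
    (hE : ∀ Q, volume (E Q) ≤ (2 ^ (d + 2) : ℝ≥0∞)⁻¹ * volume (dyadicSet Q))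
    {q r β₁ β₂ : ℝ} (hqr : q.HolderConjugate r) {f : (Fin d → ℝ) → 𝕜}
    {F : (Fin d → ℝ) → 𝕜} {G b : DyadicLabel d → (Fin d → ℝ) → 𝕜}
    {a c : DyadicLabel d → DyadicLabel d → (Fin d → ℝ) → 𝕜}
    (hGm : ∀ Q, AEMeasurable (G Q)) (hbm : ∀ Q, AEMeasurable (b Q))
    (ham : ∀ Q P, AEMeasurable (a Q P)) (hcm : ∀ Q P, AEMeasurable (c Q P)) {B₁ B₂ : ℝ≥0∞}
    (hG : ∀ Q, ∀ᵐ x, x ∈ dyadicSet Q → nextCube (E Q) Q x = none →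
      ‖G Q x‖ₑ ≤ B₁ * normLLogL β₁ (dyadicNine Q) f)
    (ha : ∀ Q P x, nextCube (E Q) Q x = some P → ∫⁻ y in dyadicSet P, ‖a Q P y‖ₑ ^ q ≤
      (B₁ * normLLogL β₁ (dyadicNine Q) f) ^ q * volume (dyadicSet P))
    (hb : ∀ Q, ∫⁻ y in dyadicSet Q, ‖b Q y‖ₑ ^ q ≤
      (B₁ * normLLogL β₁ (dyadicNine Q) f) ^ q * volume (dyadicSet Q))
    (hc : ∀ Q P x, nextCube (E Q) Q x = some P → ∫⁻ y in dyadicSet P, ‖c Q P y‖ₑ ^ q ≤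
      (B₂ * normLLogL β₂ (dyadicNine Q) f) ^ q * volume (dyadicSet P))
    (hstep : ∀ Q P x, nextCube (E Q) Q x = some P →
      ∀ᵐ y, G Q y = a Q P y - b P y + c Q P y + G P y)
    (htopG : ∀ x, G (top x) =ᵐ[volume] F) :
    ∃ H₁ H₂ : (Fin d → ℝ) → 𝕜, AEStronglyMeasurable H₁ ∧ AEStronglyMeasurable H₂ ∧
      (∀ g : (Fin d → ℝ) → 𝕜, AEStronglyMeasurable g volume → ∫⁻ x, ‖H₁ x‖ₑ * ‖g x‖ₑ ≤
        2 * B₁ * sparseForm (dyadicNine '' stoppingFamily E top) β₁ r f g) ∧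
      (∀ g : (Fin d → ℝ) → 𝕜, AEStronglyMeasurable g volume → ∫⁻ x, ‖H₂ x‖ₑ * ‖g x‖ₑ ≤
        B₂ * sparseForm (dyadicNine '' stoppingFamily E top) β₂ r f g) ∧
      ∀ᵐ x, F x = H₁ x + H₂ x := by
  have hq : 0 < q := hqr.pos
  have hS := stoppingCube_isSelection (E := E) htop
  set s := stoppingCube E top with hs
  set ψ : DyadicLabel d → (Fin d → ℝ) → 𝕜 := fun Q x =>
    (nextCube (E Q) Q x).elim (G Q x) (a Q · x) with hψ
  set γ : DyadicLabel d → (Fin d → ℝ) → 𝕜 := fun Q x =>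
    (nextCube (E Q) Q x).elim 0 (c Q · x) with hγ
  have hψm : ∀ Q, AEMeasurable (ψ Q) := fun Q =>
    (nextCube_isSelection (E Q) Q).aemeasurable_comp (V := fun o x => o.elim (G Q x) (a Q · x))
      (by rintro (_ | P); exacts [hGm Q, ham Q P])
  have hγm : ∀ Q, AEMeasurable (γ Q) := fun Q =>
    (nextCube_isSelection (E Q) Q).aemeasurable_comp (V := fun o x => o.elim 0 (c Q · x))
      (by rintro (_ | P); exacts [aemeasurable_const, hcm Q P])
  have hsm : ∀ {φ : DyadicLabel d → (Fin d → ℝ) → 𝕜}, (∀ Q, AEMeasurable (φ Q)) →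
      ∀ k, AEMeasurable fun x => (s k x).elim 0 (φ · x) := fun {φ} hφ k =>
    (hS k).aemeasurable_comp (V := fun o x => o.elim 0 (φ · x))
      (by rintro (_ | P); exacts [aemeasurable_const, hφ P])
  -- The term `b` belongs to the child, hence the shift by one generation: it is estimated with the
  -- norm on the child's own dilate.
  set h₁ : ℕ → (Fin d → ℝ) → 𝕜 := fun k x =>
    (s k x).elim 0 (ψ · x) - (s (k + 1) x).elim 0 (b · x) with hh₁
  set h₂ : ℕ → (Fin d → ℝ) → 𝕜 := fun k x => (s k x).elim 0 (γ · x) with hh₂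
  have hend := ae_exists_stoppingCube_eq_none htop hE
  have hz₁ : ∀ {x K}, s K x = none → ∀ k ≥ K, h₁ k x = 0 := by
    intro x K hK k hk
    simp only [hh₁, hs]
    rw [stoppingCube_eq_none_mono hk hK, stoppingCube_eq_none_mono (Nat.le_succ_of_le hk) hK]
    simp
  have hz₂ : ∀ {x K}, s K x = none → ∀ k ≥ K, h₂ k x = 0 := by
    intro x K hK k hk
    simp only [hh₂, hs]
    rw [stoppingCube_eq_none_mono hk hK]
    simp
  have hS₁ : ∀ᵐ x, ‖∑' k, h₁ k x‖ₑ ≤ (∑' k, (s k x).elim 0 (fun Q => ‖ψ Q x‖ₑ)) +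
      ∑' k, (s k x).elim 0 (fun Q => ‖b Q x‖ₑ) := by
    filter_upwards [hend] with x ⟨K, hK⟩
    have hel : ∀ (o : Option (DyadicLabel d)) (φ : DyadicLabel d → 𝕜),
      ‖o.elim 0 φ‖ₑ = o.elim 0 (fun Q => ‖φ Q‖ₑ) := by rintro (_ | Q) φ <;> simp
    calc ‖∑' k, h₁ k x‖ₑ ≤ ∑' k, ‖h₁ k x‖ₑ := enorm_tsum_le_of_eventually_zero (hz₁ hK)
      _ ≤ ∑' k, ((s k x).elim 0 (fun Q => ‖ψ Q x‖ₑ) +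
          (s (k + 1) x).elim 0 (fun Q => ‖b Q x‖ₑ)) := by
        refine ENNReal.tsum_le_tsum fun k => ?_
        rw [← hel, ← hel]
        exact enorm_sub_le
      _ ≤ _ := by
        rw [ENNReal.tsum_add]
        refine add_le_add le_rfl ?_
        -- Only generations from 1 on occur for `b`; adding the top generation can only increase the
        -- sum.
        exact ENNReal.tsum_comp_le_tsum_of_injective (add_left_injective 1)
          fun k => (s k x).elim 0 (fun Q => ‖b Q x‖ₑ)
  have hS₂ : ∀ᵐ x, ‖∑' k, h₂ k x‖ₑ ≤ ∑' k, (s k x).elim 0 (fun Q => ‖γ Q x‖ₑ) := by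
    filter_upwards [hend] with x ⟨K, hK⟩
    refine (enorm_tsum_le_of_eventually_zero (hz₂ hK)).trans (ENNReal.tsum_le_tsum fun k => ?_)
    simp only [hh₂]
    cases s k x <;> simp
  refine ⟨fun x => ∑' k, h₁ k x, fun x => ∑' k, h₂ k x, ?_, ?_, ?_, ?_, ?_⟩
  · refine AEMeasurable.tsum_eventually_zero (fun k => (hsm hψm k).sub (hsm hbm (k + 1))) ?_
    filter_upwards [hend] with x ⟨K, hK⟩
    exact ⟨K, hz₁ hK⟩
  · refine AEMeasurable.tsum_eventually_zero (fun k => hsm hγm k) ?_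
    filter_upwards [hend] with x ⟨K, hK⟩
    exact ⟨K, hz₂ hK⟩
  · intro g hg
    have hm : AEMeasurable fun x => (∑' k, (s k x).elim 0 (fun Q => ‖ψ Q x‖ₑ)) * ‖g x‖ₑ := by
      refine (AEMeasurable.tsum fun k => ?_).mul hg.enorm
      exact (hS k).aemeasurable_comp (V := fun o x => o.elim 0 (fun Q => ‖ψ Q x‖ₑ))
        (by rintro (_ | P); exacts [aemeasurable_const, (hψm P).enorm])
    calc _ ≤ ∫⁻ x, ((∑' k, (s k x).elim 0 (fun Q => ‖ψ Q x‖ₑ)) * ‖g x‖ₑ +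
          (∑' k, (s k x).elim 0 (fun Q => ‖b Q x‖ₑ)) * ‖g x‖ₑ) := by
          refine lintegral_mono_ae ?_
          filter_upwards [hS₁] with x hx
          rw [← add_mul]
          gcongr
      _ = _ := lintegral_add_left' hm _
      _ ≤ _ := add_le_add
          (lintegral_stoppingCube_le_sparseForm htop hE hqr (fun Q => (hψm Q).enorm) hg
            fun Q => lintegral_nextCube_rpow_le hq.le (hG Q) (ha Q))
          (lintegral_stoppingCube_le_sparseForm htop hE hqr (fun Q => (hbm Q).enorm) hg hb)
      _ = _ := by rw [two_mul, add_mul]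
  · intro g hg
    calc _ ≤ ∫⁻ x, (∑' k, (s k x).elim 0 (fun Q => ‖γ Q x‖ₑ)) * ‖g x‖ₑ := by
          refine lintegral_mono_ae ?_
          filter_upwards [hS₂] with x hx
          gcongr
      _ ≤ _ := lintegral_stoppingCube_le_sparseForm htop hE hqr (fun Q => (hγm Q).enorm) hg
            fun Q => lintegral_nextCube_rpow_le hq.le (by simp) (hc Q)
  · have hstep' : ∀ᵐ y, ∀ Q P, (∃ x, nextCube (E Q) Q x = some P) →
        G Q y = a Q P y - b P y + c Q P y + G P y := by
      refine ae_all_iff.2 fun Q => ae_all_iff.2 fun P => ?_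
      by_cases h : ∃ x, nextCube (E Q) Q x = some P
      · obtain ⟨x, hx⟩ := h
        filter_upwards [hstep Q P x hx] with y hy _ using hy
      · exact Filter.Eventually.of_forall fun y hy => absurd hy h
    have htop' : ∀ᵐ y, ∀ Q, (∃ x, top x = Q) → G Q y = F y := by
      refine ae_all_iff.2 fun Q => ?_
      by_cases h : ∃ x, top x = Q
      · obtain ⟨x, rfl⟩ := h
        filter_upwards [htopG x] with y hy _ using hy
      · exact Filter.Eventually.of_forall fun y hy => absurd hy h
    filter_upwards [hend, hstep', htop'] with x ⟨K, hK⟩ h1 h2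
    have htel : ∀ n, F x = (∑ k ∈ Finset.range n, h₁ k x) + (∑ k ∈ Finset.range n, h₂ k x) +
        (s n x).elim 0 (G · x) := by
      intro n
      induction n with
      | zero => simp [hs, stoppingCube, h2 (top x) ⟨x, rfl⟩]
      | succ n ih =>
        have hn : (s n x).elim 0 (G · x) = h₁ n x + h₂ n x + (s (n + 1) x).elim 0 (G · x) := by
          have hsucc : s (n + 1) x = (s n x).bind fun Q => nextCube (E Q) Q x := rfl
          simp only [hh₁, hh₂, hsucc]
          rcases s n x with _ | Q
          · simp
          · simp only [Option.elim_some, Option.bind_some, hψ, hγ]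
            rcases hP : nextCube (E Q) Q x with _ | P
            · simp
            · simp only [Option.elim_some]
              rw [h1 Q P ⟨x, hP⟩]
        rw [ih, hn, Finset.sum_range_succ, Finset.sum_range_succ]
        ring
    rw [htel K, show s K x = none from hK, tsum_eq_sum (s := Finset.range K) fun k hk => hz₁ hK k (by simpa using hk),
      tsum_eq_sum (s := Finset.range K) fun k hk => hz₂ hK k (by simpa using hk)]
    simp

end Telescoping

/-! ### Localization and linear operators -/

section Operators

variable {d : ℕ} {𝕜 : Type*} [RCLike 𝕜]

theorem coeFn_cutOff (Q : Cube d) (f : MeasFun d 𝕜) :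
    cutOff Q f =ᵐ[volume] (Q.triple.toSet)ᶜ.indicator f := AEEqFun.coeFn_mk _ _

theorem cutOff_sub (Q : Cube d) (f g : MeasFun d 𝕜) :
    cutOff Q (f - g) = cutOff Q f - cutOff Q g := by
  refine AEEqFun.ext ?_
  filter_upwards [coeFn_cutOff Q (f - g), coeFn_cutOff Q f, coeFn_cutOff Q g,
    AEEqFun.coeFn_sub f g, AEEqFun.coeFn_sub (cutOff Q f) (cutOff Q g)] with x h1 h2 h3 h4 h5
  rw [h1, h5, Pi.sub_apply, h2, h3]
  by_cases hx : x ∈ (Q.triple.toSet)ᶜ <;> simp [hx, h4]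

theorem coeFn_sub_cutOff (Q : Cube d) (f : MeasFun d 𝕜) :
    (f - cutOff Q f : MeasFun d 𝕜) =ᵐ[volume] Q.triple.toSet.indicator f := by
  filter_upwards [coeFn_cutOff Q f, AEEqFun.coeFn_sub f (cutOff Q f)] with x h1 h2
  rw [h2, Pi.sub_apply, h1]
  by_cases hx : x ∈ Q.triple.toSet <;> simp [hx]

/-- The restriction of `f` to the nine times dilated dyadic cube with label `Q`. -/
noncomputable def localize (Q : DyadicLabel d) (f : MeasFun d 𝕜) : MeasFun d 𝕜 :=
  f - cutOff (dyadicCube Q).triple f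

theorem coeFn_localize (Q : DyadicLabel d) (f : MeasFun d 𝕜) :
    localize Q f =ᵐ[volume] (dyadicNine Q).toSet.indicator f := coeFn_sub_cutOff _ f

theorem IsBddCompactSupp.localize {f : MeasFun d 𝕜} (hf : IsBddCompactSupp f) (Q : DyadicLabel d) :
    IsBddCompactSupp (localize Q f) := by
  obtain ⟨⟨M, hM⟩, B, hB, hfB⟩ := hf
  refine ⟨⟨M, ?_⟩, B, hB, ?_⟩
  · filter_upwards [hM, coeFn_localize Q f] with x h1 h2
    rw [h2]
    exact (norm_indicator_le_norm_self _ _).trans h1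
  · filter_upwards [hfB, coeFn_localize Q f] with x h1 h2 hx
    rw [h2]
    by_cases hxQ : x ∈ (dyadicNine Q).toSet <;> simp [hxQ, h1 hx]

theorem cutOff_localize {P Q : DyadicLabel d} (h : (dyadicNine P).toSet ⊆ (dyadicNine Q).toSet)
    (f : MeasFun d 𝕜) :
    cutOff (dyadicCube P).triple (localize Q f) = localize Q f - localize P f := by
  refine AEEqFun.ext ?_
  filter_upwards [coeFn_cutOff (dyadicCube P).triple (localize Q f), coeFn_localize Q f,
    coeFn_localize P f, AEEqFun.coeFn_sub (localize Q f) (localize P f)] with x h1 h2 h3 h4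
  rw [h1, h4, Pi.sub_apply, h3]
  change (dyadicNine P).toSetᶜ.indicator _ x = _
  by_cases hP : x ∈ (dyadicNine P).toSet
  · simp [hP, h2, h hP]
  · simp [hP]

theorem opApply_of_mem {T : LinOp d 𝕜} {f : MeasFun d 𝕜} (hf : f ∈ T.domain) :
    opApply T f = T ⟨f, hf⟩ := dif_pos hf

theorem opApply_sub {T : LinOp d 𝕜} {f g : MeasFun d 𝕜} (hf : f ∈ T.domain) (hg : g ∈ T.domain) :
    opApply T (f - g) = opApply T f - opApply T g := by
  rw [opApply_of_mem hf, opApply_of_mem hg, opApply_of_mem (sub_mem hf hg), ← LinearPMap.map_sub]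
  rfl

theorem measFun_aemeasurable (f : MeasFun d 𝕜) : AEMeasurable f volume :=
  f.aestronglyMeasurable.aemeasurable

theorem eLpNorm_ofReal_rpow {q : ℝ} (hq : 0 < q) (u : (Fin d → ℝ) → 𝕜) :
    eLpNorm u (ENNReal.ofReal q) volume ^ q = ∫⁻ x, ‖u x‖ₑ ^ q := by
  rw [eLpNorm_eq_lintegral_rpow_enorm_toReal (by simpa using hq) ENNReal.ofReal_ne_top,
    ENNReal.toReal_ofReal hq.le, ← ENNReal.rpow_mul, one_div_mul_cancel hq.ne', ENNReal.rpow_one]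

theorem lintegral_rpow_le_of_grandMaximal_le {T : LinOp d 𝕜} {q : ℝ} (hq : 0 < q)
    {f : MeasFun d 𝕜} {Q : Cube d} {x : Fin d → ℝ} (hx : x ∈ Q.toSet) {κ : ℝ≥0∞}
    (h : grandMaximal T q f x ≤ κ) :
    ∫⁻ y in Q.toSet, ‖opApply T (cutOff Q f) y‖ₑ ^ q ≤ κ ^ q * volume Q.toSet := by
  have h1 := (le_iSup₂_of_le (f := fun (Q : Cube d) (_ : x ∈ Q.toSet) =>
    volume Q.toSet ^ (-(1 / q)) *
      eLpNorm (Q.toSet.indicator (opApply T (cutOff Q f) : (Fin d → ℝ) → 𝕜))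
        (ENNReal.ofReal q) volume) Q hx le_rfl).trans h
  have hv0 : volume Q.toSet ^ (1 / q) ≠ 0 := by
    simp [ENNReal.rpow_eq_zero_iff, Q.volume_toSet_ne_zero, Q.volume_toSet_ne_top]
  have hvt : volume Q.toSet ^ (1 / q) ≠ ∞ :=
    ENNReal.rpow_ne_top_of_nonneg (by positivity) Q.volume_toSet_ne_top
  rw [ENNReal.rpow_neg, ENNReal.inv_mul_le_iff hv0 hvt] at h1
  have h2 := ENNReal.rpow_le_rpow h1 hq.le
  rw [eLpNorm_ofReal_rpow hq, ENNReal.mul_rpow_of_nonneg _ _ hq.le, ← ENNReal.rpow_mul,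
    one_div_mul_cancel hq.ne', ENNReal.rpow_one, mul_comm] at h2
  refine le_trans (le_of_eq ?_) h2
  rw [← lintegral_indicator Q.measurableSet_toSet]
  congr 1
  ext y
  by_cases hy : y ∈ Q.toSet <;> simp [hy, hq]

theorem BoundedOnLp.lintegral_rpow_le {T : LinOp d 𝕜} {q A : ℝ} (hT : BoundedOnLp T q A)
    (hq : 0 < q) {u : MeasFun d 𝕜} {κ : ℝ≥0∞} (hκ : κ ≠ ∞) (hu : ∫⁻ x, ‖u x‖ₑ ^ q ≤ κ) :
    ∫⁻ x, ‖opApply T u x‖ₑ ^ q ≤ ENNReal.ofReal A ^ q * κ := by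
  have hmem : MemLp u (ENNReal.ofReal q) volume := by
    refine ⟨u.aestronglyMeasurable, lt_top_iff_ne_top.2 fun h => ?_⟩
    have h1 := eLpNorm_ofReal_rpow hq u
    rw [h, ENNReal.top_rpow_of_pos hq] at h1
    exact hκ (top_le_iff.1 (h1.trans_le hu))
  have h2 := ENNReal.rpow_le_rpow (hT u hmem).2 hq.le
  rw [ENNReal.mul_rpow_of_nonneg _ _ hq.le, eLpNorm_ofReal_rpow hq, eLpNorm_ofReal_rpow hq] at h2
  exact h2.trans (by gcongr)

/-- A bound on ∫ |H||g| yields at once the absolute convergence and the estimate of the integral. -/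
theorem sparseControlled_mk {H : (Fin d → ℝ) → 𝕜} (hH : AEStronglyMeasurable H volume)
    {S : Set (Cube d)} {β r A : ℝ} {f : MeasFun d 𝕜} {B : ℝ≥0∞} (hB : B ≤ ENNReal.ofReal A)
    (h : ∀ g : (Fin d → ℝ) → 𝕜, AEStronglyMeasurable g volume →
      ∫⁻ x, ‖H x‖ₑ * ‖g x‖ₑ ≤ B * sparseForm S β r f g) :
    SparseControlled (AEEqFun.mk H hH) A S β r f := by
  intro g hg
  have h1 : ∫⁻ x, ‖AEEqFun.mk H hH x * g x‖ₑ ≤ ENNReal.ofReal A * sparseForm S β r f g := by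
    refine le_trans (le_of_eq ?_) ((h g hg).trans (by gcongr))
    refine lintegral_congr_ae ?_
    filter_upwards [AEEqFun.coeFn_mk H hH] with x hx
    rw [hx, enorm_mul]
  refine ⟨fun hfin => ⟨(AEEqFun.aestronglyMeasurable _).mul hg, ?_⟩, ?_⟩
  · exact h1.trans_lt (ENNReal.mul_lt_top ENNReal.ofReal_lt_top (lt_top_iff_ne_top.2 hfin))
  · exact (enorm_integral_le_lintegral_enorm _).trans h1

end Operators

/-! ### The main theorem: exceptional sets and estimates of the error terms -/

theorem mainTheorem4 {𝕜 : Type*} [RCLike 𝕜] (d : ℕ) (hd : 2 ≤ d)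
    (β₁ β₂ : ℝ) (hβ₁ : 0 ≤ β₁) (hβ₂ : 0 ≤ β₂) (K : ℝ) (hK : 0 < K) :
    ∃ C : ℝ, 0 < C ∧
      ∀ (r A A₀ A₁ A₂ : ℝ), 1 < r → r ≤ 3 / 2 → 0 ≤ A → 0 ≤ A₀ → 0 ≤ A₁ → 0 ≤ A₂ →
      ∀ T₁ T₂ : LinOp d 𝕜,
        -- the functions `T₂ f`, `T₁ T₂ f` and `T₁ (χ_{ℝ^d \ 3Q} T₂ f)` are defined
        (∀ f : MeasFun d 𝕜, IsBddCompactSupp f →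
          f ∈ T₂.domain ∧ opApply T₂ f ∈ T₁.domain ∧
            ∀ Q : Cube d, cutOff Q (opApply T₂ f) ∈ T₁.domain) →
        BoundedOnLp T₁ (r / (r - 1)) A →
        WeakLLogL (fun f x => ‖opApply T₁ (opApply T₂ f) x‖ₑ) β₁ A₀ K →
        WeakLLogL (fun f => grandMaximal T₁ (r / (r - 1)) (opApply T₂ f)) β₁ A₁ K →
        WeakLLogL (fun f => grandMaximal T₂ (r / (r - 1)) f) β₂ A₂ K →
        ∀ f : MeasFun d 𝕜, IsBddCompactSupp f →
          ∃ (S : Set (Cube d)) (H₁ H₂ : MeasFun d 𝕜),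
            IsSparse (1 / 2 * (1 / 9 ^ d)) S ∧
            SparseControlled H₁ (C * (A₀ + A₁)) S β₁ r f ∧
            SparseControlled H₂ (C * (A * A₂)) S β₂ r f ∧
            ∀ᵐ x, opApply T₁ (opApply T₂ f) x = H₁ x + H₂ x := by
  -- Three weak type bounds, each K D⁻¹ 9^d |Q|, must sum to at most 2^(-d-2)|Q|; the summand 1
  -- secures `1 ≤ D`.
  set D : ℝ := 1 + 3 * K * 9 ^ d * 2 ^ (d + 2) with hDdef
  have hD1 : 1 ≤ D := by rw [hDdef]; linarith [show 0 ≤ 3 * K * 9 ^ d * 2 ^ (d + 2) by positivity]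
  have hD0 : 0 < D := by linarith
  -- The 2 is needed for H₁, the 3^d for H₂.
  refine ⟨2 * 3 ^ d * D, by positivity, ?_⟩
  intro r A A₀ A₁ A₂ hr1 hr32 hA hA₀ hA₁ hA₂ T₁ T₂ hdom hT₁ hW₀ hW₁ hW₂ f hf
  set q := r / (r - 1) with hqdef
  have hqr : q.HolderConjugate r := (Real.HolderConjugate.conjExponent hr1).symm
  have hq : 0 < q := hqr.pos
  obtain ⟨⟨M, hM⟩, B, hB, hfB⟩ := id hf
  have hN₁ : ∀ Q : Cube d, normLLogL β₁ Q f ≠ ∞ := fun Q => normLLogL_ne_top hβ₁ hM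
  have hN₂ : ∀ Q : Cube d, normLLogL β₂ Q f ≠ ∞ := fun Q => normLLogL_ne_top hβ₂ hM
  obtain ⟨ρ, hρ⟩ := hB.isBounded.subset_closedBall 0
  obtain ⟨N, hN⟩ := pow_unbounded_of_one_lt ρ (one_lt_two)
  have hloc := fun Q => hf.localize Q
  set Tf : DyadicLabel d → MeasFun d 𝕜 := fun Q => opApply T₂ (localize Q f) with hTf
  set G : DyadicLabel d → MeasFun d 𝕜 := fun Q => opApply T₁ (Tf Q) with hGdef
  set a : DyadicLabel d → DyadicLabel d → MeasFun d 𝕜 :=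
    fun Q P => opApply T₁ (cutOff (dyadicCube P) (Tf Q)) with hadef
  set c : DyadicLabel d → DyadicLabel d → MeasFun d 𝕜 := fun Q P =>
    opApply T₁ ((Tf Q - Tf P) - cutOff (dyadicCube P) (Tf Q - Tf P)) with hcdef
  set E : DyadicLabel d → Set (Fin d → ℝ) := fun Q =>
    {x | ENNReal.ofReal (D * A₀) * normLLogL β₁ (dyadicNine Q) f < ‖G Q x‖ₑ} ∪
    {x | ENNReal.ofReal (D * A₁) * normLLogL β₁ (dyadicNine Q) f < grandMaximal T₁ q (Tf Q) x} ∪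
    {x | ENNReal.ofReal (D * A₂) * normLLogL β₂ (dyadicNine Q) f <
      grandMaximal T₂ q (localize Q f) x} with hEdef
  have hE : ∀ Q, volume (E Q) ≤ (2 ^ (d + 2) : ℝ≥0∞)⁻¹ * volume (dyadicSet Q) := by
    intro Q
    have h0 := hW₀.volume_lt_le hβ₁ hA₀ hD1 (hloc Q) (coeFn_localize Q f) (hN₁ _)
    have h1 := hW₁.volume_lt_le hβ₁ hA₁ hD1 (hloc Q) (coeFn_localize Q f) (hN₁ _)
    have h2 := hW₂.volume_lt_le hβ₂ hA₂ hD1 (hloc Q) (coeFn_localize Q f) (hN₂ _)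
    refine (measure_union_le _ _).trans ((add_le_add ((measure_union_le _ _).trans
      (add_le_add h0 h1)) h2).trans ?_)
    rw [volume_dyadicNine]
    have hreal : 3 * (K * (D⁻¹ * 9 ^ d)) ≤ (2 ^ (d + 2))⁻¹ := by
      rw [show 3 * (K * (D⁻¹ * 9 ^ d)) = 3 * K * 9 ^ d / D by ring, div_le_iff₀ hD0,
        ← div_eq_inv_mul, le_div_iff₀ (by positivity), hDdef]
      linarith
    have henn : 3 * (ENNReal.ofReal K * (ENNReal.ofReal D⁻¹ * 9 ^ d)) ≤
        (2 ^ (d + 2) : ℝ≥0∞)⁻¹ := by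
      have := ENNReal.ofReal_le_ofReal hreal
      rwa [ENNReal.ofReal_mul (by norm_num), ENNReal.ofReal_mul hK.le,
        ENNReal.ofReal_mul (by positivity), ENNReal.ofReal_pow (by norm_num),
        ENNReal.ofReal_inv_of_pos (x := 2 ^ (d + 2)) (by positivity),
        ENNReal.ofReal_pow (p := 2) (by norm_num), ENNReal.ofReal_ofNat, ENNReal.ofReal_ofNat,
        ENNReal.ofReal_ofNat] at this
    calc _ = 3 * (ENNReal.ofReal K * (ENNReal.ofReal D⁻¹ * 9 ^ d)) * volume (dyadicSet Q) := by ring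
      _ ≤ _ := by gcongr
  have hnotMem : ∀ {Q x}, x ∉ E Q →
      ‖G Q x‖ₑ ≤ ENNReal.ofReal (D * A₀) * normLLogL β₁ (dyadicNine Q) f ∧
      grandMaximal T₁ q (Tf Q) x ≤ ENNReal.ofReal (D * A₁) * normLLogL β₁ (dyadicNine Q) f ∧
      grandMaximal T₂ q (localize Q f) x ≤
        ENNReal.ofReal (D * A₂) * normLLogL β₂ (dyadicNine Q) f := by
    intro Q x hx
    simp only [hEdef, Set.mem_union, Set.mem_ofPred_eq, not_or, not_lt] at hx
    exact ⟨hx.1.1, hx.1.2, hx.2⟩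
  have hB₀ : ENNReal.ofReal (D * A₀) ≤ ENNReal.ofReal (D * (A₀ + A₁)) :=
    ENNReal.ofReal_le_ofReal (by gcongr; linarith)
  have hB₁ : ENNReal.ofReal (D * A₁) ≤ ENNReal.ofReal (D * (A₀ + A₁)) :=
    ENNReal.ofReal_le_ofReal (by gcongr; linarith)
  have htop := topCube_isSelection (d := d) N
  have ha : ∀ Q P y, y ∈ dyadicSet P → y ∉ E Q → ∫⁻ y in dyadicSet P, ‖a Q P y‖ₑ ^ q ≤
      (ENNReal.ofReal (D * (A₀ + A₁)) * normLLogL β₁ (dyadicNine Q) f) ^ q *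
        volume (dyadicSet P) := by
    intro Q P y hyP hyE
    have h1 := lintegral_rpow_le_of_grandMaximal_le hq (dyadicSet_subset_dyadicCube P hyP)
      ((hnotMem hyE).2.1.trans (mul_le_mul' hB₁ le_rfl))
    rw [volume_dyadicCube] at h1
    exact (lintegral_mono_set (dyadicSet_subset_dyadicCube P)).trans h1
  have hTfdom : ∀ Q, Tf Q ∈ T₁.domain := fun Q => (hdom _ (hloc Q)).2.1
  have hcutdom : ∀ Q P, cutOff (dyadicCube P) (Tf Q) ∈ T₁.domain :=
    fun Q P => (hdom _ (hloc Q)).2.2 _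
  have hc : ∀ Q P x, nextCube (E Q) Q x = some P → ∫⁻ y in dyadicSet P, ‖c Q P y‖ₑ ^ q ≤
      (ENNReal.ofReal (3 ^ d * D * (A * A₂)) * normLLogL β₂ (dyadicNine Q) f) ^ q *
        volume (dyadicSet P) := by
    intro Q P x hx
    obtain ⟨y, hyP, hyE⟩ := exists_notMem_of_nextCube_eq_some (hE Q) hx
    have hsub := dyadicNine_mono (level_lt_of_nextCube_eq_some (hE Q) hx).le
      ((nextCube_isSelection _ _).mem hx) (mem_of_nextCube_eq_some hx)
    have hw : opApply T₂ (cutOff (dyadicCube P).triple (localize Q f)) = Tf Q - Tf P := by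
      rw [cutOff_localize hsub, opApply_sub (hdom _ (hloc Q)).1 (hdom _ (hloc P)).1]
    -- The maximal function is tested on 3P, whose triple is 9P: the cut-off of f_Q is then f_Q −
    -- f_P.
    have h1 := lintegral_rpow_le_of_grandMaximal_le hq
      (Cube.toSet_subset_triple _ (dyadicSet_subset_dyadicCube P hyP)) (hnotMem hyE).2.2
    rw [hw, Cube.volume_triple, volume_dyadicCube] at h1
    set κ := ENNReal.ofReal (D * A₂) * normLLogL β₂ (dyadicNine Q) f with hκ
    have hκt : κ ≠ ∞ := ENNReal.mul_ne_top ENNReal.ofReal_ne_top (hN₂ _)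
    have h2 : ∫⁻ z, ‖(Tf Q - Tf P - cutOff (dyadicCube P) (Tf Q - Tf P) : MeasFun d 𝕜) z‖ₑ ^ q ≤
        κ ^ q * (3 ^ d * volume (dyadicSet P)) := by
      refine le_trans (le_of_eq ?_) h1
      rw [← lintegral_indicator (Cube.measurableSet_toSet _)]
      refine lintegral_congr_ae ?_
      filter_upwards [coeFn_sub_cutOff (dyadicCube P) (Tf Q - Tf P)] with z hz
      rw [hz]
      by_cases hzP : z ∈ (dyadicCube P).triple.toSet <;> simp [hzP, hq]
    have h3 := hT₁.lintegral_rpow_le hq (ENNReal.mul_ne_top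
      (ENNReal.rpow_ne_top_of_nonneg hq.le hκt) (ENNReal.mul_ne_top (by finiteness)
        (volume_dyadicSet_ne_top P))) h2
    refine (setLIntegral_le_lintegral _ _).trans (h3.trans ?_)
    -- |3P| costs 3^(d/q), bounded by 3^d since q ≥ 1; this keeps the constant independent of `r`.
    have h4 : (3 ^ d : ℝ≥0∞) ≤ (3 ^ d) ^ q := by
      refine ENNReal.le_rpow_self_of_one_le ?_ hqr.lt.le
      exact one_le_pow₀ (by norm_num)
    have h5 : ENNReal.ofReal (3 ^ d * D * (A * A₂)) * normLLogL β₂ (dyadicNine Q) f =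
        ENNReal.ofReal A * κ * 3 ^ d := by
      rw [show 3 ^ d * D * (A * A₂) = A * (D * A₂) * 3 ^ d by ring,
        ENNReal.ofReal_mul (by positivity), ENNReal.ofReal_mul hA, hκ,
        ENNReal.ofReal_pow (by norm_num), ENNReal.ofReal_ofNat]
      ring
    rw [h5, ENNReal.mul_rpow_of_nonneg (ENNReal.ofReal A * κ) _ hq.le,
      ENNReal.mul_rpow_of_nonneg (ENNReal.ofReal A) κ hq.le]
    calc _ ≤ ENNReal.ofReal A ^ q * (κ ^ q * ((3 ^ d) ^ q * volume (dyadicSet P))) := by gcongr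
      _ = _ := by ring
  have hstep : ∀ Q P, G Q = a Q P - a P P + c Q P + G P := by
    intro Q P
    simp only [hGdef, hadef, hcdef]
    rw [cutOff_sub, opApply_sub (sub_mem (hTfdom Q) (hTfdom P))
      (sub_mem (hcutdom Q P) (hcutdom P P)), opApply_sub (hTfdom Q) (hTfdom P),
      opApply_sub (hcutdom Q P) (hcutdom P P)]
    abel
  obtain ⟨H₁, H₂, hm₁, hm₂, hH₁, hH₂, hsum⟩ := exists_decomposition_of_stoppingCube
    (E := E) (top := topCube N) htop hE hqr (f := f) (β₁ := β₁) (β₂ := β₂)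
    (F := opApply T₁ (opApply T₂ f)) (G := fun Q => G Q) (b := fun Q => a Q Q)
    (a := fun Q P => a Q P) (c := fun Q P => c Q P)
    (B₁ := ENNReal.ofReal (D * (A₀ + A₁))) (B₂ := ENNReal.ofReal (3 ^ d * D * (A * A₂)))
    (fun Q => measFun_aemeasurable _) (fun Q => measFun_aemeasurable _)
    (fun Q P => measFun_aemeasurable _) (fun Q P => measFun_aemeasurable _)
    (fun Q => by
      filter_upwards [ae_notMem_of_nextCube_eq_none (E Q) Q] with x hx hxQ hn
      exact (hnotMem (hx hxQ hn)).1.trans (mul_le_mul' hB₀ le_rfl))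
    (fun Q P x hx => by
      obtain ⟨y, hyP, hyE⟩ := exists_notMem_of_nextCube_eq_some (hE Q) hx
      exact ha Q P y hyP hyE)
    (fun Q => by
      -- The same estimate with P = Q: the set `E Q` is smaller than `Q`, so it misses a point of
      -- it.
      obtain ⟨y, hy, hyE⟩ : ∃ y ∈ dyadicSet Q, y ∉ E Q := by
        by_contra! hsub
        refine ((measure_mono hsub).trans (hE Q)).not_gt ?_
        have h2 : (2 ^ (d + 2) : ℝ≥0∞)⁻¹ < 1 := by
          rw [ENNReal.inv_lt_one]
          exact one_lt_pow₀ (by norm_num) (by omega)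
        simpa using ENNReal.mul_lt_mul_left (volume_dyadicSet_ne_zero Q)
          (volume_dyadicSet_ne_top Q) h2
      exact ha Q Q y hy hyE)
    hc
    (fun Q P x _ => by
      filter_upwards [AEEqFun.coeFn_add (a Q P - a P P + c Q P) (G P),
        AEEqFun.coeFn_add (a Q P - a P P) (c Q P), AEEqFun.coeFn_sub (a Q P) (a P P)]
        with y h1 h2 h3
      rw [hstep Q P, h1, Pi.add_apply, h2, Pi.add_apply, h3, Pi.sub_apply])
    (fun x => by
      have : localize (topCube N x) f = f := by
        refine AEEqFun.ext ?_
        filter_upwards [coeFn_localize (topCube N x) f, hfB] with y h1 h2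
        rw [h1]
        by_cases hy : y ∈ (dyadicNine (topCube N x)).toSet
        · simp [hy]
        · rw [Set.indicator_of_notMem hy, h2]
          exact fun hyB => hy (closedBall_subset_dyadicNine_topCube N x
            (Metric.closedBall_subset_closedBall hN.le (hρ hyB)))
      simp only [hGdef, hTf, this]
      exact Filter.EventuallyEq.rfl)
  refine ⟨_, AEEqFun.mk H₁ hm₁, AEEqFun.mk H₂ hm₂, stoppingFamily_isSparse htop hE,
    sparseControlled_mk hm₁ ?_ hH₁, sparseControlled_mk hm₂ ?_ hH₂, ?_⟩
  · rw [← ENNReal.ofReal_ofNat, ← ENNReal.ofReal_mul (by norm_num)]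
    refine ENNReal.ofReal_le_ofReal ?_
    have h3 : (1 : ℝ) ≤ 3 ^ d := one_le_pow₀ (by norm_num)
    have h4 : 0 ≤ D * (A₀ + A₁) := by positivity
    nlinarith
  · refine ENNReal.ofReal_le_ofReal ?_
    have h4 : 0 ≤ 3 ^ d * D * (A * A₂) := by positivity
    linarith
  · filter_upwards [hsum, AEEqFun.coeFn_mk H₁ hm₁, AEEqFun.coeFn_mk H₂ hm₂] with x h1 h2 h3
    rw [h1, h2, h3]
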